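/- \textbf{Setting.} Let $\Sigma$ be a finite nonempty alphabet and $\mathcal A=(Q,\delta,I,Q_F\cup\delta_F)$ a Büchi automaton with finite state set $Q$, transition function $\delta\colon Q\times\Sigma\to 2^Q$, initial states $I$, accepting states $Q_F\subseteq Q$ and accepting transitions $\delta_F\subseteq\delta$. A run on a word $w\in\Sigma^\omega$ is an infinite sequence of states respecting $\delta$; it is accepting if some accepting state or some accepting transition occurs in it infinitely often, and $\mathcal L(\mathcal A)$ is the set of words that have an accepting run from $I$. An SCC is a set of mutually reachable states (every state reaches itself), an MSCC is a maximal SCC; an MSCC $C$ is \emph{trivial} if $|C|=1$ and no transition stays inside $C$. Assume that accepting states and accepting transitions occur only inside non-trivial MSCCs. \textbf{Tight rank upper bounds.} The run DAG $\mathcal G_w$ has as vertices the pairs $(q,i)$ such that some run from $I$ on $w$ is in $q$ at position $i$, and as edges the transitions between consecutive levels. A vertex is finite if it reaches only finitely many vertices, and endangered if it reaches no accepting vertex and no accepting edge. Let $\mathcal G^0=\mathcal G_w$; for $j=0,1,\dots,2|Q|$ let $\mathcal G^{j+1}$ be $\mathcal G^j$ without its finite vertices ($j$ even), respectively without its endangered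 vertices ($j$ odd). The vertices removed in step $j$ have rank $j$, those never removed have rank $\omega$. Let $\mathrm{level}_w(k)$ be the set of $q$ with $(q,k)\in\mathcal G_w$, and let $f^w_k(q)$ be the rank of $(q,k)$ if $q\in\mathrm{level}_w(k)$ and $0$ otherwise. A ranking is a map $f\colon Q\to\{0,\dots,2|Q|\}$ with even values on $Q_F$; it is tight if its maximum $r$ is odd and $1,3,\dots,r$ are all values of $f$. A level $\ell$ is tight if for all $k\ge\ell$ the map $f^w_k$ is a tight ranking with the same maximum as $f^w_\ell$. A map $\mu$ from $2^Q$ to rankings is a \emph{TRUB} if for every $w\notin\mathcal L(\mathcal A)$ on which $\mathcal A$ has at least one run from $I$ there is a tight level $\ell$ with $f^w_k\le\mu(\mathrm{level}_w(k))$ pointwise for all $k\ge\ell$. A function $\chi\colon Q\to\omega$ is called a TRUB if the constant map $S\mapsto\chi$ is one (in particular $\chi$ is then a ranking). \textbf{Labelling procedure.} A set $C$ of states is \emph{IWA} if every cycle inside $C$ contains an accepting state or an accepting transition, \emph{non-accepting} if it contains neither (otherwise accepting), and \emph{deterministic} if every $q\in C$ has, for each letter, at most one successor in $C$. Each MSCC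 $C$ gets a type in $\{\mathsf{IWA},\mathsf D,\mathsf N,\mathsf G\}$ and a rank. If $C$ is terminal (no transition leads from $C$ to another MSCC), it gets $\mathsf{IWA}{:}0$ if it is IWA (T1); else $\mathsf D{:}2$ if it is deterministic and accepting (T2); else $\mathsf G{:}2|C\setminus Q_F|$ (T3). If $C$ is not terminal, its children (the other MSCCs entered by a transition from $C$) are labelled first. Let $\ell_D,\ell_N,\ell_W,\ell_G$ be the maximal ranks of its children of type $\mathsf D,\mathsf N,\mathsf{IWA},\mathsf G$; terms for types without a child are omitted from all maxima. Let $c_D$ be $0$ if for each child $C'$ of type $\mathsf D$ and rank $\ell_D$ the set $\delta(C,\Sigma)\cap(C\cup C')$ is deterministic, and $2$ otherwise; define $c_W$ likewise for $\mathsf{IWA}$ and $\ell_W$. Put \[\begin{aligned} r_{\mathsf{IWA}}&=\max\{\ell_D,\ \ell_N+1,\ \ell_W,\ \ell_G\},\\ r_{\mathsf D}&=\max\{\ell_D+c_D,\ \ell_N+1,\ \ell_W+c_W,\ \ell_G+2,\ 2\},\\ r_{\mathsf N}&=\max\{\ell_D+1,\ \ell_N,\ \ell_W+1,\ \ell_G+1\},\\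 r_{\mathsf G}&=\max\{\ell_D,\ \ell_N+1,\ \ell_W,\ \ell_G\}+2|C\setminus Q_F|. \end{aligned}\] (I1) If $C$ is trivial, its rank is $\max\{\ell_D,\ell_N,\ell_W,\ell_G\}$ and its type is any type attaining this maximum. (I2) Else if $C$ is IWA, it gets $\mathsf{IWA}{:}r_{\mathsf{IWA}}$. (I3) Else if $C$ is deterministic and accepting, it gets $\mathsf D{:}r_{\mathsf D}$. (I4) Else if $C$ is deterministic and non-accepting, it gets whichever of $\mathsf D{:}r_{\mathsf D}$ and $\mathsf N{:}r_{\mathsf N}$ has the smaller rank. (I5) Else if $C$ is non-accepting, it gets $\mathsf N{:}r_{\mathsf N}$. (I6) Otherwise it gets $\mathsf G{:}r_{\mathsf G}$. Let $\chi(q)$ be the rank of the MSCC of $q$. \textbf{Lemma.} The procedure yields a labelling of the MSCCs, and for every labelling it can yield (whatever choices are made in I1), $\chi$ is a TRUB. -/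

import Mathlib

/-- A nondeterministic Büchi automaton with state set `Q` and alphabet `Γ`, with accepting
states `acc` and accepting transitions `accTrans`; `(p, a, q)` stands for the transition
from `p` to `q` reading `a`. -/
structure BuchiAutomaton (Q Γ : Type*) where
  δ : Q → Γ → Set Q
  init : Set Q
  acc : Set Q
  accTrans : Set (Q × Γ × Q)
  accTrans_sub : ∀ p a q, (p, a, q) ∈ accTrans → q ∈ δ p a

/-- The types that the labelling procedure assigns to components: inherently weak accepting,
deterministic, non-accepting, general. -/
inductive CompType
  | IWA
  | D
  | N
  | G

/-- A label (a type and a rank) for every set of states; only its values on maximal strongly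
connected components matter. -/
structure CompLabelling (Q : Type*) where
  typ : Set Q → CompType
  rk : Set Q → ℕ

namespace BuchiAutomaton

variable {Q Γ : Type*}

/-! ### Runs and language -/

/-- `ρ` is a run from `q` over the word `w`. -/
def IsRun (A : BuchiAutomaton Q Γ) (w : ℕ → Γ) (q : Q) (ρ : ℕ → Q) : Prop :=
  ρ 0 = q ∧ ∀ i, ρ (i + 1) ∈ A.δ (ρ i) (w i)

/-- Some accepting state, or some accepting transition, occurs infinitely often. -/
def IsAcceptingRun (A : BuchiAutomaton Q Γ) (w : ℕ → Γ) (ρ : ℕ → Q) : Prop :=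
  (∃ q ∈ A.acc, ∃ᶠ i in Filter.atTop, ρ i = q) ∨
    (∃ t ∈ A.accTrans, ∃ᶠ i in Filter.atTop, (ρ i, w i, ρ (i + 1)) = t)

def language (A : BuchiAutomaton Q Γ) : Set (ℕ → Γ) :=
  {w | ∃ q ∈ A.init, ∃ ρ, A.IsRun w q ρ ∧ A.IsAcceptingRun w ρ}

/-! ### Run DAGs and ranks -/

/-- Vertices of the run DAG over `w`. -/
def dagV (A : BuchiAutomaton Q Γ) (w : ℕ → Γ) : Set (Q × ℕ) :=
  {v | ∃ q ∈ A.init, ∃ ρ, A.IsRun w q ρ ∧ ρ v.2 = v.1}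

/-- Edges of the subgraph of the run DAG over `w` induced by the vertex set `W`. -/
def dagEdge (A : BuchiAutomaton Q Γ) (w : ℕ → Γ) (W : Set (Q × ℕ)) (u v : Q × ℕ) : Prop :=
  u ∈ W ∧ v ∈ W ∧ v.2 = u.2 + 1 ∧ v.1 ∈ A.δ u.1 (w u.2)

def dagReach (A : BuchiAutomaton Q Γ) (w : ℕ → Γ) (W : Set (Q × ℕ)) : Q × ℕ → Q × ℕ → Prop :=
  Relation.ReflTransGen (A.dagEdge w W)

/-- `v` is finite in the subgraph induced by `W`. -/
def IsFiniteVertex (A : BuchiAutomaton Q Γ) (w : ℕ → Γ) (W : Set (Q × ℕ)) (v : Q × ℕ) : Prop :=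
  {u | A.dagReach w W v u}.Finite

/-- `v` is endangered in the subgraph induced by `W`: it reaches neither an accepting vertex
nor an accepting edge. -/
def IsEndangered (A : BuchiAutomaton Q Γ) (w : ℕ → Γ) (W : Set (Q × ℕ)) (v : Q × ℕ) : Prop :=
  (∀ u, A.dagReach w W v u → u.1 ∉ A.acc) ∧
    ∀ u u', A.dagReach w W v u → A.dagEdge w W u u' → (u.1, w u.2, u'.1) ∉ A.accTrans

/-- The vertex sets of the subgraphs `𝒢^0 ⊇ 𝒢^1 ⊇ …` of the ranking procedure. -/
def dagIter (A : BuchiAutomaton Q Γ) (w : ℕ → Γ) : ℕ → Set (Q × ℕ)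
  | 0 => A.dagV w
  | j + 1 => {v | v ∈ dagIter A w j ∧
      ¬ ((Even j ∧ A.IsFiniteVertex w (dagIter A w j) v) ∨
          (Odd j ∧ A.IsEndangered w (dagIter A w j) v))}

/-- The rank of a vertex: the unique `j ∈ {0, …, 2|Q|}` such that the `j`-th step removes it,
and `⊤` (for `ω`) if there is none. -/
noncomputable def vertexRank (A : BuchiAutomaton Q Γ) (w : ℕ → Γ) (v : Q × ℕ) : ℕ∞ :=
  ⨅ (j : ℕ) (_ : j ≤ 2 * Nat.card Q ∧ v ∈ A.dagIter w j ∧ v ∉ A.dagIter w (j + 1)), (j : ℕ∞)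

def level (A : BuchiAutomaton Q Γ) (w : ℕ → Γ) (k : ℕ) : Set Q :=
  {q | (q, k) ∈ A.dagV w}

open Classical in
/-- The ranking of the `k`-th level of the run DAG over `w`. -/
noncomputable def levelRanking (A : BuchiAutomaton Q Γ) (w : ℕ → Γ) (k : ℕ) (q : Q) : ℕ∞ :=
  if q ∈ A.level w k then A.vertexRank w (q, k) else 0

/-! ### Rankings and tight rank upper bounds -/

/-- `f` takes values in `{0, …, 2|Q|}` and even values on accepting states. -/
def IsRanking (A : BuchiAutomaton Q Γ) (f : Q → ℕ∞) : Prop :=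
  (∀ q, f q ≤ ((2 * Nat.card Q : ℕ) : ℕ∞)) ∧ ∀ q ∈ A.acc, ∃ m : ℕ, Even m ∧ f q = (m : ℕ∞)

/-- The rank (maximal value) of a ranking. -/
noncomputable def rankingRank (f : Q → ℕ∞) : ℕ∞ := ⨆ q, f q

def IsTight (A : BuchiAutomaton Q Γ) (f : Q → ℕ∞) : Prop :=
  A.IsRanking f ∧ ∃ r : ℕ, Odd r ∧ rankingRank f = (r : ℕ∞) ∧
    ∀ i : ℕ, Odd i → i ≤ r → ∃ q, f q = (i : ℕ∞)

def IsTightLevel (A : BuchiAutomaton Q Γ) (w : ℕ → Γ) (l : ℕ) : Prop :=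
  ∀ k, l ≤ k → A.IsTight (A.levelRanking w k) ∧
    rankingRank (A.levelRanking w k) = rankingRank (A.levelRanking w l)

/-- `μ` is a tight rank upper bound with respect to the word `w`. -/
def IsTrubWrt (A : BuchiAutomaton Q Γ) (μ : Set Q → Q → ℕ∞) (w : ℕ → Γ) : Prop :=
  ∃ l, A.IsTightLevel w l ∧ ∀ k, l ≤ k → ∀ q, A.levelRanking w k q ≤ μ (A.level w k) q

/-- `μ` is a tight rank upper bound: it maps sets of states to rankings and is a tight rank
upper bound with respect to every rejected word on which `A` has at least one run.
(If `A` has no run on `w`, the run DAG is empty, all level rankings vanish, and no level can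
be tight.) -/
def IsTrub (A : BuchiAutomaton Q Γ) (μ : Set Q → Q → ℕ∞) : Prop :=
  (∀ S, A.IsRanking (μ S)) ∧
    ∀ w, w ∉ A.language → (∃ q ∈ A.init, ∃ ρ, A.IsRun w q ρ) → A.IsTrubWrt μ w

/-! ### Strongly connected components -/

def Reach (A : BuchiAutomaton Q Γ) : Q → Q → Prop :=
  Relation.ReflTransGen fun p q => ∃ a, q ∈ A.δ p a

def IsSCC (A : BuchiAutomaton Q Γ) (C : Set Q) : Prop :=
  ∀ p ∈ C, ∀ q ∈ C, A.Reach p q ∧ A.Reach q p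

def IsMSCC (A : BuchiAutomaton Q Γ) (C : Set Q) : Prop := Maximal A.IsSCC C

/-- The maximal strongly connected component of the state `q`. -/
def mscc (A : BuchiAutomaton Q Γ) (q : Q) : Set Q := {p | A.Reach q p ∧ A.Reach p q}

theorem mem_mscc (A : BuchiAutomaton Q Γ) (q : Q) : q ∈ A.mscc q :=
  ⟨Relation.ReflTransGen.refl, Relation.ReflTransGen.refl⟩

theorem isMSCC_mscc (A : BuchiAutomaton Q Γ) (q : Q) : A.IsMSCC (A.mscc q) :=
  ⟨fun _ hp _ hr => ⟨hp.2.trans hr.1, hr.2.trans hp.1⟩,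
    fun _ hD hle _ hp => hD q (hle (A.mem_mscc q)) _ hp⟩

theorem IsMSCC.eq_mscc {A : BuchiAutomaton Q Γ} {C : Set Q} (hC : A.IsMSCC C) {q : Q}
    (hq : q ∈ C) : C = A.mscc q :=
  hC.eq_of_subset (A.isMSCC_mscc q).1 fun p hp => hC.1 q hq p hp

/-- `|C| = 1` and there is no transition inside `C`. -/
def IsTrivialComp (A : BuchiAutomaton Q Γ) (C : Set Q) : Prop :=
  C.ncard = 1 ∧ ∀ p ∈ C, ∀ a, ∀ q ∈ C, q ∉ A.δ p a

def IsNonAcc (A : BuchiAutomaton Q Γ) (C : Set Q) : Prop :=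
  (∀ q ∈ C, q ∉ A.acc) ∧ ∀ p ∈ C, ∀ a, ∀ q ∈ C, (p, a, q) ∉ A.accTrans

/-- Inherently weak accepting: every cycle inside `C` contains an accepting state or an
accepting transition. -/
def IsIWA (A : BuchiAutomaton Q Γ) (C : Set Q) : Prop :=
  ∀ (k : ℕ) (p : ℕ → Q) (a : ℕ → Γ), 0 < k → p k = p 0 → (∀ i ≤ k, p i ∈ C) →
    (∀ i < k, p (i + 1) ∈ A.δ (p i) (a i)) →
    ∃ i < k, p i ∈ A.acc ∨ (p i, a i, p (i + 1)) ∈ A.accTrans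

/-- The restriction of the transition function to `C` is deterministic. -/
def IsDet (A : BuchiAutomaton Q Γ) (C : Set Q) : Prop :=
  ∀ q ∈ C, ∀ a, (A.δ q a ∩ C).Subsingleton

/-- The transitions between the components `C₁` and `C₂` are deterministic: `A` restricted to
`δ(C₁, Γ) ∩ (C₁ ∪ C₂)` is deterministic. -/
def IsDetBetween (A : BuchiAutomaton Q Γ) (C₁ C₂ : Set Q) : Prop :=
  A.IsDet ({q | ∃ p ∈ C₁, ∃ a, q ∈ A.δ p a} ∩ (C₁ ∪ C₂))

/-- `D` is a child of `C` in the condensation. -/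
def IsChild (A : BuchiAutomaton Q Γ) (C D : Set Q) : Prop :=
  A.IsMSCC D ∧ D ≠ C ∧ ∃ p ∈ C, ∃ q ∈ D, ∃ a, q ∈ A.δ p a

def IsTerminal (A : BuchiAutomaton Q Γ) (C : Set Q) : Prop := ∀ D, ¬ A.IsChild C D

/-- Accepting states and accepting transitions occur only inside non-trivial maximal strongly
connected components. -/
def AccInsideNontrivial (A : BuchiAutomaton Q Γ) : Prop :=
  (∀ q ∈ A.acc, ∃ C, A.IsMSCC C ∧ ¬ A.IsTrivialComp C ∧ q ∈ C) ∧
    ∀ p a q, (p, a, q) ∈ A.accTrans →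
      ∃ C, A.IsMSCC C ∧ ¬ A.IsTrivialComp C ∧ p ∈ C ∧ q ∈ C

/-! ### The labelling procedure -/

section Labelling

variable [Finite Q]

/-- The maximal rank of a child of `C` of type `t`, and `⊥` if there is no such child
(so that its term drops out of every maximum). -/
noncomputable def childRank (A : BuchiAutomaton Q Γ) (L : CompLabelling Q) (C : Set Q)
    (t : CompType) : WithBot ℕ :=
  (Set.toFinite {D : Set Q | A.IsChild C D ∧ L.typ D = t}).toFinset.sup
    fun D => ((L.rk D : ℕ) : WithBot ℕ)

open Classical in
/-- `0` if all transitions from `C` to its children of type `t` with the maximal rank are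
deterministic, and `2` otherwise. -/
noncomputable def detIncr (A : BuchiAutomaton Q Γ) (L : CompLabelling Q) (C : Set Q)
    (t : CompType) : WithBot ℕ :=
  if ∀ D, A.IsChild C D → L.typ D = t → ((L.rk D : ℕ) : WithBot ℕ) = A.childRank L C t →
    A.IsDetBetween C D then 0 else 2

noncomputable def trivialRule (A : BuchiAutomaton Q Γ) (L : CompLabelling Q) (C : Set Q) :
    WithBot ℕ :=
  A.childRank L C .D ⊔ A.childRank L C .N ⊔ A.childRank L C .IWA ⊔ A.childRank L C .G

noncomputable def iwaRule (A : BuchiAutomaton Q Γ) (L : CompLabelling Q) (C : Set Q) :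
    WithBot ℕ :=
  A.childRank L C .D ⊔ (A.childRank L C .N + 1) ⊔ A.childRank L C .IWA ⊔ A.childRank L C .G

noncomputable def detRule (A : BuchiAutomaton Q Γ) (L : CompLabelling Q) (C : Set Q) :
    WithBot ℕ :=
  (A.childRank L C .D + A.detIncr L C .D) ⊔ (A.childRank L C .N + 1) ⊔
    (A.childRank L C .IWA + A.detIncr L C .IWA) ⊔ (A.childRank L C .G + 2) ⊔ 2

noncomputable def nonAccRule (A : BuchiAutomaton Q Γ) (L : CompLabelling Q) (C : Set Q) :
    WithBot ℕ :=
  (A.childRank L C .D + 1) ⊔ A.childRank L C .N ⊔ (A.childRank L C .IWA + 1) ⊔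
    (A.childRank L C .G + 1)

noncomputable def generalRule (A : BuchiAutomaton Q Γ) (L : CompLabelling Q) (C : Set Q) :
    WithBot ℕ :=
  (A.childRank L C .D ⊔ (A.childRank L C .N + 1) ⊔ A.childRank L C .IWA ⊔ A.childRank L C .G) +
    ((2 * (C \ A.acc).ncard : ℕ) : WithBot ℕ)

open Classical in
/-- The rules for a terminal component `C`. -/
def TerminalRule (A : BuchiAutomaton Q Γ) (L : CompLabelling Q) (C : Set Q) : Prop :=
  if A.IsIWA C then L.typ C = .IWA ∧ L.rk C = 0
  else if A.IsDet C ∧ ¬ A.IsNonAcc C then L.typ C = .D ∧ L.rk C = 2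
  else L.typ C = .G ∧ L.rk C = 2 * (C \ A.acc).ncard

open Classical in
/-- The rules for a non-terminal component `C`. In the trivial case any type attaining the
maximum may be chosen; for a deterministic non-accepting component the rule with the smaller
rank is used. -/
def InnerRule (A : BuchiAutomaton Q Γ) (L : CompLabelling Q) (C : Set Q) : Prop :=
  if A.IsTrivialComp C then
    ((L.rk C : ℕ) : WithBot ℕ) = A.trivialRule L C ∧
      A.childRank L C (L.typ C) = A.trivialRule L C
  else if A.IsIWA C then
    L.typ C = .IWA ∧ ((L.rk C : ℕ) : WithBot ℕ) = A.iwaRule L C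
  else if A.IsDet C ∧ ¬ A.IsNonAcc C then
    L.typ C = .D ∧ ((L.rk C : ℕ) : WithBot ℕ) = A.detRule L C
  else if A.IsDet C ∧ A.IsNonAcc C then
    (L.typ C = .D ∧ ((L.rk C : ℕ) : WithBot ℕ) = A.detRule L C ∧
        A.detRule L C ≤ A.nonAccRule L C) ∨
      (L.typ C = .N ∧ ((L.rk C : ℕ) : WithBot ℕ) = A.nonAccRule L C ∧
        A.nonAccRule L C ≤ A.detRule L C)
  else if A.IsNonAcc C then
    L.typ C = .N ∧ ((L.rk C : ℕ) : WithBot ℕ) = A.nonAccRule L C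
  else
    L.typ C = .G ∧ ((L.rk C : ℕ) : WithBot ℕ) = A.generalRule L C

/-- `L` is a result of the labelling procedure. Since the rules for a component refer only to
its children in the (acyclic) condensation, this determines `L` on the components up to the
choice between types of equal rank for trivial components. -/
def IsLabelling (A : BuchiAutomaton Q Γ) (L : CompLabelling Q) : Prop :=
  ∀ C, A.IsMSCC C →
    (A.IsTerminal C → A.TerminalRule L C) ∧ (¬ A.IsTerminal C → A.InnerRule L C)

end Labelling

/-- Every state gets the rank of its maximal strongly connected component. -/
def chi (A : BuchiAutomaton Q Γ) (L : CompLabelling Q) (q : Q) : ℕ := L.rk (A.mscc q)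

end BuchiAutomaton

/-!
Fix a rejected word. By well-founded induction on the condensation, every vertex of the run DAG
whose state lies in a component `C` is removed by the ranking procedure at the latest in step
`rk C` (`IsLabelling.rankLE`); no restriction to late levels is needed. The labels of type `N` are
odd and all others even (`IsLabelling.rk_mod_two`), and this parity decides how a vertex of `C`
can survive step `r = rk C`:

* If `r` is even, a surviving vertex of `C` starts an infinite path of surviving vertices. The
  children of `C` have rank at most `r`, so the path stays in `C` (`exists_path_in`). Being
  rejecting, it has only finitely many accepting steps. This is impossible for trivial and
  inherently weak components (`rankLE_of_isTrivialComp`, `rankLE_of_isIWA`). In a deterministic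
  component, everything that branches off a late part of the path was endangered one step
  earlier, hence so was the path (`rankLE_of_isDet`). In a general component, each pair of
  steps above the ranks of the children takes a state of `C \ acc` away from all late levels
  (`rankLE_add_two_mul_ncard`).
* If `r` is odd, all surviving successors of `C` in the children are endangered, and `C` adds
  nothing accepting (`rankLE_of_isNonAcc`, `rankLE_of_isTrivialComp`).

The ranks of a labelling are at most `2 * Nat.card Q` (`IsLabelling.rk_le`), so this also shows that
the ranking procedure removes every vertex. A tight level then exists by the usual argument
(`exists_isTightLevel`): an odd-indexed subgraph that is not empty contains an endangered vertex,
since a path that keeps moving towards the nearest accepting step would be an accepting run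
(`exists_isEndangered`), and an infinite path from there meets every later level.

Labellings exist because the rules at a component involve only its children, which reach strictly
fewer states (`exists_isLabelling`).
-/

namespace BuchiAutomaton

variable {Q Γ : Type*} {A : BuchiAutomaton Q Γ} {w : ℕ → Γ} {W : Set (Q × ℕ)}

/-! ### Infinite paths in the run DAG -/

/-- The step from `p` to `q` reading `a` starts in an accepting state or is an accepting
transition. -/
def IsAccStep (A : BuchiAutomaton Q Γ) (p : Q) (a : Γ) (q : Q) : Prop :=
  p ∈ A.acc ∨ (p, a, q) ∈ A.accTrans

/-- `ρ` lists the states of an infinite path over `w` that starts at level `k`, so its `i`-th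
vertex is `(ρ i, k + i)`. It need not start in the run DAG. -/
def IsPath (A : BuchiAutomaton Q Γ) (w : ℕ → Γ) (k : ℕ) (ρ : ℕ → Q) : Prop :=
  ∀ i, ρ (i + 1) ∈ A.δ (ρ i) (w (k + i))

/-- Since there are only finitely many transitions, a run with infinitely many accepting steps
repeats one of them. -/
theorem isAcceptingRun_of_frequently [Finite Q] [Finite Γ] {ρ : ℕ → Q}
    (h : ∃ᶠ i in Filter.atTop, A.IsAccStep (ρ i) (w i) (ρ (i + 1))) :
    A.IsAcceptingRun w ρ := by
  by_contra hn
  simp only [IsAcceptingRun, not_or, not_exists, not_and, Filter.not_frequently] at hn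
  have h1 : ∀ᶠ i in Filter.atTop, ∀ q : Q, q ∈ A.acc → ¬ ρ i = q :=
    Filter.eventually_all.2 fun q => by
      by_cases hq : q ∈ A.acc
      · exact (hn.1 q hq).mono fun _ h _ => h
      · exact Filter.Eventually.of_forall fun _ h => absurd h hq
  have h2 : ∀ᶠ i in Filter.atTop, ∀ t : Q × Γ × Q, t ∈ A.accTrans →
      ¬ (ρ i, w i, ρ (i + 1)) = t :=
    Filter.eventually_all.2 fun t => by
      by_cases ht : t ∈ A.accTrans
      · exact (hn.2 t ht).mono fun _ h _ => h
      · exact Filter.Eventually.of_forall fun _ h => absurd h ht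
  obtain ⟨i, hi, h1, h2⟩ := (h.and_eventually (h1.and h2)).exists
  rcases hi with hi | hi
  · exact h1 _ hi rfl
  · exact h2 _ hi rfl

/-- A path of the run DAG of a rejected word extends to a run from an initial state, so it has
only finitely many accepting steps. -/
theorem IsPath.eventually_not_isAccStep [Finite Q] [Finite Γ] (hw : w ∉ A.language)
    {v : Q × ℕ} (hv : v ∈ A.dagV w) {ρ : ℕ → Q} (h0 : ρ 0 = v.1) (hρ : A.IsPath w v.2 ρ) :
    ∃ N, ∀ i ≥ N, ¬ A.IsAccStep (ρ i) (w (v.2 + i)) (ρ (i + 1)) := by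
  by_contra! hcon
  obtain ⟨q, hq, σ, hσ, hσv⟩ := hv
  refine hw ⟨q, hq, fun i => if i < v.2 then σ i else ρ (i - v.2), ⟨?_, fun i => ?_⟩,
    isAcceptingRun_of_frequently (Filter.frequently_atTop.2 fun n => ?_)⟩
  · by_cases h : 0 < v.2
    · simpa [h] using hσ.1
    · have h' : v.2 = 0 := by omega
      simp only [h', lt_irrefl, if_false, Nat.sub_zero, h0, ← hσv]
      exact hσ.1
  · rcases lt_trichotomy (i + 1) v.2 with h | h | h
    · have h' : i < v.2 := by omega
      simpa only [h, h', if_true] using hσ.2 i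
    · have h' : i < v.2 := by omega
      have := hσ.2 i
      simp only [h', h, lt_irrefl, if_true, if_false, Nat.sub_self, h0, ← hσv] at this ⊢
      exact this
    · have h1 : ¬ i + 1 < v.2 := by omega
      have h2 : ¬ i < v.2 := by omega
      have := hρ (i - v.2)
      rw [show i - v.2 + 1 = i + 1 - v.2 by omega, show v.2 + (i - v.2) = i by omega] at this
      simpa only [h1, h2, if_false] using this
  · obtain ⟨i, hi, h⟩ := hcon n
    refine ⟨v.2 + i, by omega, ?_⟩
    have h1 : ¬ v.2 + i + 1 < v.2 := by omega
    have h2 : ¬ v.2 + i < v.2 := by omega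
    simpa only [h1, h2, if_false, show v.2 + i + 1 - v.2 = i + 1 by omega,
      Nat.add_sub_cancel_left] using h

/-- Dependent choice: a set of vertices in which every vertex has a successor contains an
infinite path. The successor function `s` is prescribed so that the path can be steered. -/
theorem exists_path_of_step {P : Q × ℕ → Prop} (s : Q × ℕ → Q × ℕ)
    (hs : ∀ v, P v → A.dagEdge w W v (s v) ∧ P (s v)) {v : Q × ℕ} (hv : P v) :
    ∃ ρ : ℕ → Q, ρ 0 = v.1 ∧ A.IsPath w v.2 ρ ∧ ∀ i, P (ρ i, v.2 + i) ∧
      s (ρ i, v.2 + i) = (ρ (i + 1), v.2 + (i + 1)) := by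
  have key : ∀ i, P (s^[i] v) ∧ (s^[i] v).2 = v.2 + i := by
    intro i
    induction i with
    | zero => exact ⟨hv, rfl⟩
    | succ i ih =>
      rw [Function.iterate_succ_apply']
      obtain ⟨h1, h2⟩ := hs _ ih.1
      exact ⟨h2, by rw [h1.2.2.1, ih.2]; rfl⟩
  have eq : ∀ i, ((s^[i] v).1, v.2 + i) = s^[i] v := fun i => by rw [← (key i).2]
  refine ⟨fun i => (s^[i] v).1, rfl, fun i => ?_, fun i => ⟨?_, ?_⟩⟩
  · have := (hs _ (key i).1).1.2.2.2
    rwa [(key i).2, ← Function.iterate_succ_apply' s] at this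
  · simpa only [eq] using (key i).1
  · simp only [eq]
    rw [← Function.iterate_succ_apply' s]

theorem exists_path {P : Q × ℕ → Prop} (hs : ∀ v, P v → ∃ u, A.dagEdge w W v u ∧ P u)
    {v : Q × ℕ} (hv : P v) :
    ∃ ρ : ℕ → Q, ρ 0 = v.1 ∧ A.IsPath w v.2 ρ ∧ ∀ i, P (ρ i, v.2 + i) := by
  classical
  choose! s hs using hs
  obtain ⟨ρ, h0, h1, h2⟩ := exists_path_of_step s hs hv
  exact ⟨ρ, h0, h1, fun i => (h2 i).1⟩

/-! ### Finite and endangered vertices -/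

theorem dagReach.mem {v u : Q × ℕ} (h : A.dagReach w W v u) (hv : v ∈ W) : u ∈ W := by
  induction h with
  | refl => exact hv
  | tail _ h _ => exact h.2.1

/-- Finite branching: a vertex all of whose successors are finite is finite. -/
theorem isFiniteVertex_of_succ [Finite Q] {v : Q × ℕ}
    (h : ∀ u, A.dagEdge w W v u → A.IsFiniteVertex w W u) : A.IsFiniteVertex w W v := by
  have hfin : {u | A.dagEdge w W v u}.Finite :=
    ((Set.finite_univ (α := Q)).prod (Set.finite_singleton (v.2 + 1))).subset
      fun u hu => ⟨trivial, hu.2.2.1⟩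
  refine ((Set.finite_singleton v).union (hfin.biUnion fun u hu => h u hu)).subset ?_
  intro x hx
  rcases Relation.ReflTransGen.cases_head hx with rfl | ⟨u, hu, hux⟩
  · exact Or.inl rfl
  · exact Or.inr (Set.mem_biUnion hu hux)

theorem IsEndangered.of_reach {v u : Q × ℕ} (hv : A.IsEndangered w W v)
    (h : A.dagReach w W v u) : A.IsEndangered w W u :=
  ⟨fun x hx => hv.1 x (h.trans hx), fun x y hx => hv.2 x y (h.trans hx)⟩

theorem isEndangered_of_succ {v : Q × ℕ} (hv : v.1 ∉ A.acc)
    (h : ∀ u, A.dagEdge w W v u → (v.1, w v.2, u.1) ∉ A.accTrans ∧ A.IsEndangered w W u) :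
    A.IsEndangered w W v := by
  constructor
  · intro x hx
    rcases Relation.ReflTransGen.cases_head hx with rfl | ⟨u, hu, hux⟩
    · exact hv
    · exact (h u hu).2.1 x hux
  · intro x y hx hxy
    rcases Relation.ReflTransGen.cases_head hx with rfl | ⟨u, hu, hux⟩
    · exact (h y hxy).1
    · exact (h u hu).2.2 x y hux hxy

/-- `v` reaches, in exactly `n` edges inside `W`, the start of an accepting step. -/
def AccDist (A : BuchiAutomaton Q Γ) (w : ℕ → Γ) (W : Set (Q × ℕ)) : ℕ → Q × ℕ → Prop
  | 0, v => v.1 ∈ A.acc ∨ ∃ u, A.dagEdge w W v u ∧ (v.1, w v.2, u.1) ∈ A.accTrans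
  | n + 1, v => ∃ u, A.dagEdge w W v u ∧ AccDist A w W n u

theorem exists_accDist {v : Q × ℕ} (h : ¬ A.IsEndangered w W v) : ∃ n, A.AccDist w W n v := by
  have key : ∀ u, A.dagReach w W v u → A.AccDist w W 0 u → ∃ n, A.AccDist w W n v := by
    clear h
    intro u hu h0
    induction hu using Relation.ReflTransGen.head_induction_on with
    | refl => exact ⟨0, h0⟩
    | head he _ ih => obtain ⟨n, hn⟩ := ih; exact ⟨n + 1, _, he, hn⟩
  simp only [IsEndangered, not_and_or, not_forall, not_not] at h
  rcases h with ⟨u, hu, ha⟩ | ⟨u, u', hu, he, ha⟩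
  · exact key u hu (Or.inl ha)
  · exact key u hu (Or.inr ⟨u', he, ha⟩)

/-- If every vertex has a successor, then on a rejected word every vertex reaches an endangered
one: otherwise the path that always takes a shortest way to the next accepting step is an
accepting run. -/
theorem exists_isEndangered [Finite Q] [Finite Γ] (hw : w ∉ A.language) (hW : W ⊆ A.dagV w)
    (hs : ∀ v ∈ W, ∃ u, A.dagEdge w W v u) {v : Q × ℕ} (hv : v ∈ W) :
    ∃ u, A.dagReach w W v u ∧ A.IsEndangered w W u := by
  classical
  by_contra! hcon
  have hne : ∀ x, A.dagReach w W v x → ∃ n, A.AccDist w W n x :=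
    fun x hx => exists_accDist (hcon x hx)
  have hstep : ∀ x, ∃ y, A.dagReach w W v x → A.dagEdge w W x y ∧
      (A.AccDist w W 0 x → A.IsAccStep x.1 (w x.2) y.1) ∧
      (∀ n, A.AccDist w W (n + 1) x → ¬ A.AccDist w W 0 x → ∃ m ≤ n, A.AccDist w W m y) := by
    intro x
    by_cases hx : A.dagReach w W v x
    swap
    · exact ⟨x, fun h => absurd h hx⟩
    by_cases h0 : A.AccDist w W 0 x
    · rcases h0 with h0 | ⟨y, hy, h0⟩
      · obtain ⟨y, hy⟩ := hs x (hx.mem hv)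
        exact ⟨y, fun _ => ⟨hy, fun _ => Or.inl h0, fun n _ h => absurd (Or.inl h0) h⟩⟩
      · exact ⟨y, fun _ => ⟨hy, fun _ => Or.inr h0, fun n _ h => absurd (Or.inr ⟨y, hy, h0⟩) h⟩⟩
    · have hn := Nat.find_spec (hne x hx)
      obtain ⟨n, hfind⟩ : ∃ n, Nat.find (hne x hx) = n + 1 :=
        Nat.exists_eq_succ_of_ne_zero fun h => h0 (h ▸ hn)
      rw [hfind] at hn
      obtain ⟨y, hy, hyn⟩ := hn
      refine ⟨y, fun _ => ⟨hy, fun h => absurd h h0, fun m hm _ => ⟨n, ?_, hyn⟩⟩⟩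
      have := Nat.find_min' (hne x hx) hm
      omega
  choose s hs' using hstep
  obtain ⟨ρ, h0, hρ, h⟩ := exists_path_of_step (P := A.dagReach w W v) s
    (fun x hx => ⟨(hs' x hx).1, hx.tail (hs' x hx).1⟩) Relation.ReflTransGen.refl
  obtain ⟨N, hN⟩ := hρ.eventually_not_isAccStep hw (hW hv) h0
  have hfar : ∀ n i, N ≤ i → ¬ A.AccDist w W n (ρ i, v.2 + i) := by
    intro n
    induction n using Nat.strong_induction_on with
    | _ n ih =>
      intro i hi hn
      have hnot0 : ¬ A.AccDist w W 0 (ρ i, v.2 + i) := fun h0 => by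
        have := (hs' _ (h i).1).2.1 h0
        rw [(h i).2] at this
        exact hN i hi this
      cases n with
      | zero => exact hnot0 hn
      | succ n =>
        obtain ⟨m, hm, hd⟩ := (hs' _ (h i).1).2.2 n hn hnot0
        rw [(h i).2] at hd
        exact ih m (by omega) (i + 1) (by omega) hd
  obtain ⟨n, hn⟩ := hne _ (h N).1
  exact hfar n N le_rfl hn

/-! ### The subgraphs of the ranking procedure -/

theorem dagIter_succ_subset (j : ℕ) : A.dagIter w (j + 1) ⊆ A.dagIter w j := fun _ h => h.1

theorem dagIter_antitone : Antitone (A.dagIter w) :=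
  antitone_nat_of_succ_le fun j => dagIter_succ_subset j

theorem dagIter_subset_dagV (j : ℕ) : A.dagIter w j ⊆ A.dagV w := dagIter_antitone (Nat.zero_le j)

theorem mem_dagIter_succ_of_even {j : ℕ} (hj : Even j) {v : Q × ℕ} :
    v ∈ A.dagIter w (j + 1) ↔ v ∈ A.dagIter w j ∧ ¬ A.IsFiniteVertex w (A.dagIter w j) v := by
  have : ¬ Odd j := Nat.not_odd_iff_even.2 hj
  simp [dagIter, hj, this]

theorem mem_dagIter_succ_of_odd {j : ℕ} (hj : Odd j) {v : Q × ℕ} :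
    v ∈ A.dagIter w (j + 1) ↔ v ∈ A.dagIter w j ∧ ¬ A.IsEndangered w (A.dagIter w j) v := by
  have : ¬ Even j := Nat.not_even_iff_odd.2 hj
  simp [dagIter, hj, this]

/-- A vertex that is not finite has a successor that is not finite. -/
theorem exists_dagEdge_of_odd [Finite Q] {j : ℕ} (hj : Odd j) {v : Q × ℕ}
    (hv : v ∈ A.dagIter w j) : ∃ u, A.dagEdge w (A.dagIter w j) v u := by
  obtain ⟨i, rfl⟩ : ∃ i, j = i + 1 := Nat.exists_eq_succ_of_ne_zero hj.pos.ne'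
  have hi : Even i := by simpa [Nat.odd_add_one] using hj
  have hv' := hv
  rw [mem_dagIter_succ_of_even hi] at hv'
  by_contra! hcon
  refine hv'.2 (isFiniteVertex_of_succ fun u hu => ?_)
  by_contra hfin
  exact hcon u ⟨hv, (mem_dagIter_succ_of_even hi).2 ⟨hu.2.1, hfin⟩, hu.2.2⟩

/-- On a rejected word, each step with odd index removes from all late levels a vertex that is
reachable from `v`: once an endangered vertex is reached, all its successors are endangered too. -/
theorem exists_endangered_levels [Finite Q] [Finite Γ] (hw : w ∉ A.language) {j : ℕ}
    (hj : Odd j) {v : Q × ℕ} (hv : v ∈ A.dagIter w j) :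
    ∃ K, ∀ k ≥ K, ∃ q, A.dagReach w (A.dagIter w j) v (q, k) ∧ (q, k) ∈ A.dagIter w j ∧
      (q, k) ∉ A.dagIter w (j + 1) ∧ q ∉ A.acc := by
  obtain ⟨u, hvu, hu⟩ := exists_isEndangered hw (dagIter_subset_dagV j)
    (fun v hv => exists_dagEdge_of_odd hj hv) hv
  refine ⟨u.2, fun k hk => ?_⟩
  have key : ∃ q, A.dagReach w (A.dagIter w j) u (q, k) := by
    induction k, hk using Nat.le_induction with
    | base => exact ⟨u.1, Relation.ReflTransGen.refl⟩
    | succ k _ ih =>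
      obtain ⟨q, hq⟩ := ih
      obtain ⟨y, hy⟩ := exists_dagEdge_of_odd hj (hq.mem (hvu.mem hv))
      have hy2 : y = (y.1, k + 1) := Prod.ext rfl hy.2.2.1
      rw [hy2] at hy
      exact ⟨y.1, hq.tail hy⟩
  obtain ⟨q, hq⟩ := key
  exact ⟨q, hvu.trans hq, hq.mem (hvu.mem hv),
    fun h => ((mem_dagIter_succ_of_odd hj).1 h).2 (hu.of_reach hq), hu.1 _ hq⟩

/-! ### Tight levels -/

theorem vertexRank_eq {j : ℕ} {v : Q × ℕ} (hj : j ≤ 2 * Nat.card Q) (hv : v ∈ A.dagIter w j)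
    (hv' : v ∉ A.dagIter w (j + 1)) : A.vertexRank w v = j := by
  refine le_antisymm (iInf₂_le j ⟨hj, hv, hv'⟩) (le_iInf₂ fun i hi => ?_)
  by_contra hlt
  have hlt : i < j := by simpa using hlt
  exact hi.2.2 (dagIter_antitone (Nat.succ_le_of_lt hlt) hv)

theorem exists_removal {n : ℕ} {v : Q × ℕ} (hv : v ∈ A.dagV w) (hn : v ∉ A.dagIter w (n + 1)) :
    ∃ j ≤ n, v ∈ A.dagIter w j ∧ v ∉ A.dagIter w (j + 1) := by
  induction n with
  | zero => exact ⟨0, le_rfl, hv, hn⟩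
  | succ n ih =>
    by_cases h : v ∈ A.dagIter w (n + 1)
    · exact ⟨n + 1, le_rfl, h, hn⟩
    · obtain ⟨j, hj, h⟩ := ih h
      exact ⟨j, by omega, h⟩

/-- Ranks do not increase along edges: a vertex survives as long as one of its successors. -/
theorem mem_dagIter_of_dagEdge {j : ℕ} {v u : Q × ℕ} (he : A.dagEdge w (A.dagV w) v u)
    (hu : u ∈ A.dagIter w j) : v ∈ A.dagIter w j := by
  induction j with
  | zero => exact he.1
  | succ j ih =>
    have hu' := dagIter_succ_subset j hu
    have he' : A.dagEdge w (A.dagIter w j) v u := ⟨ih hu', hu', he.2.2⟩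
    rcases Nat.even_or_odd j with hj | hj
    · rw [mem_dagIter_succ_of_even hj] at hu ⊢
      exact ⟨ih hu', fun h => hu.2 (h.subset fun x hx => hx.head he')⟩
    · rw [mem_dagIter_succ_of_odd hj] at hu ⊢
      exact ⟨ih hu', fun h => hu.2 (h.of_reach (Relation.ReflTransGen.single he'))⟩

theorem exists_reach_from_level_zero {j : ℕ} {v : Q × ℕ} (hv : v ∈ A.dagIter w j) :
    ∃ p, (p, 0) ∈ A.dagIter w j ∧ A.dagReach w (A.dagIter w j) (p, 0) v := by
  obtain ⟨q, hq, ρ, hρ, hρv⟩ := dagIter_subset_dagV j hv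
  have hdag : ∀ i, (ρ i, i) ∈ A.dagV w := fun i => ⟨q, hq, ρ, hρ, rfl⟩
  obtain ⟨p, k⟩ := v
  have key : ∀ i, (ρ i, i) ∈ A.dagIter w j →
      (ρ 0, 0) ∈ A.dagIter w j ∧ A.dagReach w (A.dagIter w j) (ρ 0, 0) (ρ i, i) := by
    intro i
    induction i with
    | zero => exact fun h => ⟨h, Relation.ReflTransGen.refl⟩
    | succ i ih =>
      intro h
      have hi := mem_dagIter_of_dagEdge ⟨hdag i, hdag (i + 1), rfl, hρ.2 i⟩ h
      exact ⟨(ih hi).1, (ih hi).2.tail ⟨hi, h, rfl, hρ.2 i⟩⟩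
  simp only at hρv
  subst hρv
  exact ⟨ρ 0, key k hv⟩

theorem finite_dagIter [Finite Q] {j : ℕ}
    (h : ∀ v ∈ A.dagIter w j, A.IsFiniteVertex w (A.dagIter w j) v) : (A.dagIter w j).Finite := by
  refine ((Set.toFinite {p | (p, 0) ∈ A.dagIter w j}).biUnion fun p hp => h _ hp).subset ?_
  intro v hv
  obtain ⟨p, hp, hpv⟩ := exists_reach_from_level_zero hv
  exact Set.mem_biUnion (x := p) hp hpv

/-- The maximal rank that occurs at all late levels is the largest odd `r` for which the `r`-th
subgraph is nonempty: the next one is finite, so late levels have no larger rank, while by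
`exists_endangered_levels` every smaller odd rank occurs at all late levels. -/
theorem exists_isTightLevel [Finite Q] [Finite Γ] (hw : w ∉ A.language)
    (hrun : ∃ q ∈ A.init, ∃ ρ, A.IsRun w q ρ)
    (hbound : ∀ v, v ∉ A.dagIter w (2 * Nat.card Q + 1)) : ∃ l, A.IsTightLevel w l := by
  classical
  obtain ⟨q₀, hq₀, ρ₀, hρ₀⟩ := hrun
  have h1 : (ρ₀ 0, 0) ∈ A.dagIter w 1 := by
    refine (mem_dagIter_succ_of_even Even.zero).2 ⟨⟨q₀, hq₀, ρ₀, hρ₀, rfl⟩, fun hfin => ?_⟩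
    have hreach : ∀ i, A.dagReach w (A.dagV w) (ρ₀ 0, 0) (ρ₀ i, i) := by
      intro i
      induction i with
      | zero => exact Relation.ReflTransGen.refl
      | succ i ih =>
        exact ih.tail ⟨⟨q₀, hq₀, ρ₀, hρ₀, rfl⟩, ⟨q₀, hq₀, ρ₀, hρ₀, rfl⟩, rfl, hρ₀.2 i⟩
    exact Set.infinite_of_injective_forall_mem (f := fun i => (ρ₀ i, i))
      (fun i j hij => (Prod.ext_iff.1 hij).2) hreach hfin
  obtain ⟨m, ⟨v, hv⟩, hm⟩ : ∃ m, (∃ v, v ∈ A.dagIter w (2 * m + 1)) ∧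
      ∀ v, v ∉ A.dagIter w (2 * m + 3) := by
    by_contra! hcon
    have : ∀ m, ∃ v, v ∈ A.dagIter w (2 * m + 1) := by
      intro m
      induction m with
      | zero => exact ⟨_, h1⟩
      | succ m ih => exact hcon m ih
    obtain ⟨v, hv⟩ := this (Nat.card Q)
    exact hbound v hv
  have hmQ : 2 * m + 1 ≤ 2 * Nat.card Q := by
    by_contra hlt
    exact hbound v (dagIter_antitone (by omega) hv)
  obtain ⟨K₀, hK₀⟩ : ∃ K, ∀ q, ∀ k ≥ K, (q, k) ∉ A.dagIter w (2 * m + 2) := by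
    have hfin : (A.dagIter w (2 * m + 2)).Finite := finite_dagIter fun v hv => by
      by_contra h
      exact hm v ((mem_dagIter_succ_of_even ⟨m + 1, by ring⟩).2 ⟨hv, h⟩)
    obtain ⟨K, hK⟩ := (hfin.image Prod.snd).bddAbove
    exact ⟨K + 1, fun q k hk hmem => by have := hK ⟨_, hmem, rfl⟩; simp at this; omega⟩
  have hocc : ∀ i ≤ m, ∃ K, ∀ k ≥ K, ∃ q, (q, k) ∈ A.dagIter w (2 * i + 1) ∧
      (q, k) ∉ A.dagIter w (2 * i + 2) := fun i hi => by
    obtain ⟨K, hK⟩ := exists_endangered_levels hw ⟨i, rfl⟩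
      (dagIter_antitone (show 2 * i + 1 ≤ 2 * m + 1 by omega) hv)
    exact ⟨K, fun k hk => by obtain ⟨q, -, h1, h2, -⟩ := hK k hk; exact ⟨q, h1, h2⟩⟩
  choose! K hK using hocc
  have hlevel : ∀ k ≥ K₀ + ∑ i ∈ Finset.range (m + 1), K i,
      A.IsTight (A.levelRanking w k) ∧
        rankingRank (A.levelRanking w k) = ((2 * m + 1 : ℕ) : ℕ∞) := by
    intro k hk
    have hval : ∀ q, ∃ j ≤ 2 * m + 1, A.levelRanking w k q = (j : ℕ∞) ∧
        (q ∈ A.acc → Even j) := by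
      intro q
      by_cases hq : q ∈ A.level w k
      · obtain ⟨j, hj, hj1, hj2⟩ := exists_removal hq (hK₀ q k (by omega))
        refine ⟨j, hj, ?_, fun hacc => ?_⟩
        · rw [levelRanking, if_pos hq, vertexRank_eq (by omega) hj1 hj2]
        · by_contra hodd
          rw [Nat.not_even_iff_odd] at hodd
          rw [mem_dagIter_succ_of_odd hodd, not_and, not_not] at hj2
          exact (hj2 hj1).1 _ Relation.ReflTransGen.refl hacc
      · exact ⟨0, Nat.zero_le _, by rw [levelRanking, if_neg hq]; rfl, fun _ => Even.zero⟩
    have hodd : ∀ i ≤ m, ∃ q, A.levelRanking w k q = ((2 * i + 1 : ℕ) : ℕ∞) := by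
      intro i hi
      have hKi : K i ≤ ∑ i ∈ Finset.range (m + 1), K i :=
        Finset.single_le_sum (f := K) (fun _ _ => Nat.zero_le _)
          (Finset.mem_range.2 (by omega))
      obtain ⟨q, hq1, hq2⟩ := hK i hi k (by omega)
      refine ⟨q, ?_⟩
      rw [levelRanking, if_pos (show q ∈ A.level w k from dagIter_subset_dagV _ hq1)]
      exact vertexRank_eq (by omega) hq1 hq2
    have hrank : rankingRank (A.levelRanking w k) = ((2 * m + 1 : ℕ) : ℕ∞) := by
      refine le_antisymm (iSup_le fun q => ?_) ?_
      · obtain ⟨j, hj, hq, -⟩ := hval q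
        rw [hq]
        exact_mod_cast hj
      · obtain ⟨q, hq⟩ := hodd m le_rfl
        exact hq ▸ le_iSup (A.levelRanking w k) q
    refine ⟨⟨⟨fun q => ?_, fun q hq => ?_⟩, 2 * m + 1, ⟨m, rfl⟩, hrank, ?_⟩, hrank⟩
    · obtain ⟨j, hj, hjq, -⟩ := hval q
      rw [hjq]
      exact_mod_cast hj.trans hmQ
    · obtain ⟨j, -, hjq, he⟩ := hval q
      exact ⟨j, he hq, hjq⟩
    · rintro _ ⟨i, rfl⟩ hi
      exact hodd i (by omega)
  exact ⟨_, fun k hk => ⟨(hlevel k hk).1, by rw [(hlevel k hk).2, (hlevel _ le_rfl).2]⟩⟩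

/-! ### Ranks inside a component -/

/-- Every vertex of the run DAG over `w` whose state lies in `C` has rank at most `n`. -/
def RankLE (A : BuchiAutomaton Q Γ) (w : ℕ → Γ) (C : Set Q) (n : ℕ) : Prop :=
  ∀ v : Q × ℕ, v.1 ∈ C → v ∉ A.dagIter w (n + 1)

theorem RankLE.not_mem {C : Set Q} {n j : ℕ} (h : A.RankLE w C n) (hj : n < j) {v : Q × ℕ}
    (hv : v.1 ∈ C) : v ∉ A.dagIter w j :=
  fun hm => h v hv (dagIter_antitone hj hm)

theorem RankLE.mono {n m : ℕ} (h : A.RankLE w C n) (hnm : n ≤ m) : A.RankLE w C m :=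
  fun _ hv => h.not_mem (by omega) hv

theorem mem_or_mem_child {C : Set Q} {p q : Q} {a : Γ} (hp : p ∈ C)
    (h : q ∈ A.δ p a) : q ∈ C ∨ ∃ D, A.IsChild C D ∧ q ∈ D := by
  by_cases hq : q ∈ C
  · exact Or.inl hq
  · exact Or.inr ⟨A.mscc q, ⟨A.isMSCC_mscc q, fun h => hq (h ▸ A.mem_mscc q),
      p, hp, q, A.mem_mscc q, a, h⟩, A.mem_mscc q⟩

theorem not_mem_accTrans_of_child (hA : A.AccInsideNontrivial) {C D : Set Q} (hC : A.IsMSCC C)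
    (hD : A.IsChild C D) {p q : Q} {a : Γ} (hp : p ∈ C) (hq : q ∈ D) :
    (p, a, q) ∉ A.accTrans := by
  intro hacc
  obtain ⟨E, hE, -, hpE, hqE⟩ := hA.2 _ _ _ hacc
  exact hD.2.1 (by rw [hD.1.eq_mscc hq, ← hE.eq_mscc hqE, hE.eq_mscc hpE, ← hC.eq_mscc hp])

/-- For even `r`, a vertex of `C` that is not finite in the `r`-th subgraph starts an infinite
path of such vertices; if the children of `C` have rank at most `r`, the path stays in `C`. -/
theorem exists_path_in [Finite Q] {C : Set Q} {r : ℕ} (hr : Even r)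
    (hch : ∀ D, A.IsChild C D → A.RankLE w D r) {v : Q × ℕ} (hvC : v.1 ∈ C)
    (hv : v ∈ A.dagIter w (r + 1)) :
    ∃ ρ : ℕ → Q, ρ 0 = v.1 ∧ A.IsPath w v.2 ρ ∧
      ∀ i, ρ i ∈ C ∧ (ρ i, v.2 + i) ∈ A.dagIter w (r + 1) := by
  refine exists_path (W := A.dagIter w (r + 1))
    (P := fun u => u.1 ∈ C ∧ u ∈ A.dagIter w (r + 1)) (fun u hu => ?_) ⟨hvC, hv⟩
  obtain ⟨x, hx⟩ := exists_dagEdge_of_odd hr.add_one hu.2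
  refine ⟨x, hx, ?_, hx.2.1⟩
  rcases mem_or_mem_child hu.1 hx.2.2.2 with h | ⟨D, hD, hxD⟩
  · exact h
  · exact absurd hx.2.1 (hch D hD x hxD)

theorem rankLE_of_isIWA [Finite Q] [Finite Γ] (hw : w ∉ A.language) {C : Set Q}
    (hI : A.IsIWA C) {r : ℕ} (hr : Even r)
    (hch : ∀ D, A.IsChild C D → A.RankLE w D r) : A.RankLE w C r := by
  intro v hvC hv
  obtain ⟨ρ, h0, hρ, h⟩ := exists_path_in hr hch hvC hv
  obtain ⟨N, hN⟩ := hρ.eventually_not_isAccStep hw (dagIter_subset_dagV _ hv) h0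
  -- A state repeats after `N`, which closes a cycle without accepting step.
  obtain ⟨i, j, hij, heq⟩ : ∃ i j : ℕ, i < j ∧ ρ (N + i) = ρ (N + j) := by
    obtain ⟨i, j, hne, heq⟩ := Finite.exists_ne_map_eq_of_infinite fun i : ℕ => ρ (N + i)
    rcases lt_or_gt_of_ne hne with hlt | hlt
    · exact ⟨i, j, hlt, heq⟩
    · exact ⟨j, i, hlt, heq.symm⟩
  obtain ⟨t, -, ht⟩ := hI (j - i) (fun t => ρ (N + i + t)) (fun t => w (v.2 + (N + i + t)))
    (by omega) (by simpa [show N + i + (j - i) = N + j by omega] using heq.symm)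
    (fun t _ => (h _).1) (fun t _ => hρ _)
  exact hN (N + i + t) (by omega) ht

theorem rankLE_of_isTrivialComp [Finite Q] (hA : A.AccInsideNontrivial)
    {C : Set Q} (hC : A.IsMSCC C) (hT : A.IsTrivialComp C) {r : ℕ}
    (hch : ∀ D, A.IsChild C D → A.RankLE w D r) : A.RankLE w C r := by
  intro v hvC hv
  rcases Nat.even_or_odd r with hr | hr
  · obtain ⟨ρ, -, hρ, h⟩ := exists_path_in hr hch hvC hv
    exact hT.2 _ (h 0).1 _ _ (h 1).1 (hρ 0)
  · refine ((mem_dagIter_succ_of_odd hr).1 hv).2 (isEndangered_of_succ (fun hacc => ?_) ?_)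
    · obtain ⟨D, hD, hDT, hvD⟩ := hA.1 _ hacc
      rw [hD.eq_mscc hvD, ← hC.eq_mscc hvC] at hDT
      exact hDT hT
    · intro u hu
      have huC : u.1 ∉ C := fun huC => hT.2 _ hvC _ _ huC hu.2.2.2
      obtain ⟨D, hD, huD⟩ := (mem_or_mem_child hvC hu.2.2.2).resolve_left huC
      refine ⟨not_mem_accTrans_of_child hA hC hD hvC huD, ?_⟩
      have := hch D hD u huD
      rw [mem_dagIter_succ_of_odd hr, not_and, not_not] at this
      exact this hu.2.1

/-- For odd `r`, in the `r`-th subgraph the vertices of the children are endangered, hence so are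
those of a non-accepting `C`. -/
theorem rankLE_of_isNonAcc (hA : A.AccInsideNontrivial) {C : Set Q} (hC : A.IsMSCC C)
    (hN : A.IsNonAcc C) {r : ℕ} (hr : Odd r)
    (hch : ∀ D, A.IsChild C D → A.RankLE w D r) : A.RankLE w C r := by
  intro v hvC hv
  refine ((mem_dagIter_succ_of_odd hr).1 hv).2 ?_
  have hchild : ∀ D, A.IsChild C D → ∀ u : Q × ℕ, u.1 ∈ D → u ∈ A.dagIter w r →
      A.IsEndangered w (A.dagIter w r) u := fun D hD u huD hu => by
    have := hch D hD u huD
    rw [mem_dagIter_succ_of_odd hr, not_and, not_not] at this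
    exact this hu
  have key : ∀ u, A.dagReach w (A.dagIter w r) v u →
      u.1 ∈ C ∨ A.IsEndangered w (A.dagIter w r) u := by
    intro u hu
    induction hu with
    | refl => exact Or.inl hvC
    | tail _ he ih =>
      rcases ih with ih | ih
      · rcases mem_or_mem_child ih he.2.2.2 with h | ⟨D, hD, hxD⟩
        · exact Or.inl h
        · exact Or.inr (hchild D hD _ hxD he.2.1)
      · exact Or.inr (ih.of_reach (Relation.ReflTransGen.single he))
  constructor
  · intro u hu
    rcases key u hu with h | h
    · exact hN.1 _ h
    · exact h.1 _ Relation.ReflTransGen.refl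
  · intro u x hu hux
    rcases key u hu with h | h
    · rcases mem_or_mem_child h hux.2.2.2 with hx | ⟨D, hD, hxD⟩
      · exact hN.2 _ h _ _ hx
      · exact not_mem_accTrans_of_child hA hC hD h hxD
    · exact h.2 _ _ Relation.ReflTransGen.refl hux

/-- For odd `r`, an infinite path inside a deterministic `C` is eventually without accepting
steps. In the `r`-th subgraph its late vertices reach, apart from the path itself, only
endangered vertices: a child of rank `r + 1` is entered deterministically, and thus not from the
path, and the surviving vertices of the other children are endangered. -/
theorem rankLE_of_isDet [Finite Q] [Finite Γ] (hA : A.AccInsideNontrivial) (hw : w ∉ A.language)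
    {C : Set Q} (hC : A.IsMSCC C) (hdet : A.IsDet C) {r : ℕ} (hr : Odd r)
    (hch : ∀ D, A.IsChild C D →
      A.RankLE w D r ∨ (A.IsDetBetween C D ∧ A.RankLE w D (r + 1))) :
    A.RankLE w C (r + 1) := by
  intro v hvC hv
  have hch' : ∀ D, A.IsChild C D → A.RankLE w D (r + 1) := fun D hD => by
    rcases hch D hD with h | h
    · exact h.mono (by omega)
    · exact h.2
  obtain ⟨ρ, h0, hρ, h⟩ := exists_path_in hr.add_one hch' hvC hv
  obtain ⟨N, hN⟩ := hρ.eventually_not_isAccStep hw (dagIter_subset_dagV _ hv) h0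
  -- The start is shifted by one so that every path vertex has a predecessor in `C`, as required
  -- for using `IsDetBetween`.
  set M := N + 1 with hM
  have hsucc : ∀ i, M ≤ i → ∀ u : Q × ℕ, A.dagEdge w (A.dagIter w r) (ρ i, v.2 + i) u →
      u = (ρ (i + 1), v.2 + (i + 1)) ∨ (A.IsEndangered w (A.dagIter w r) u ∧
        ∃ D, A.IsChild C D ∧ u.1 ∈ D) := by
    intro i hi u hu
    rcases mem_or_mem_child (h i).1 hu.2.2.2 with huC | ⟨D, hD, huD⟩
    · exact Or.inl (Prod.ext
        (hdet _ (h i).1 (w (v.2 + i)) ⟨hu.2.2.2, huC⟩ ⟨hρ i, (h (i + 1)).1⟩) hu.2.2.1)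
    · right
      refine ⟨?_, D, hD, huD⟩
      rcases hch D hD with hrk | ⟨hdb, -⟩
      · have := hrk u huD
        rw [mem_dagIter_succ_of_odd hr, not_and, not_not] at this
        exact this hu.2.1
      · exfalso
        obtain ⟨i, rfl⟩ : ∃ j, i = j + 1 := Nat.exists_eq_succ_of_ne_zero (by omega)
        have heq : u.1 = ρ (i + 1 + 1) := hdb (ρ (i + 1))
          ⟨⟨ρ i, (h i).1, _, hρ i⟩, Or.inl (h (i + 1)).1⟩ (w (v.2 + (i + 1)))
          ⟨hu.2.2.2, ⟨_, (h (i + 1)).1, _, hu.2.2.2⟩, Or.inr huD⟩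
          ⟨hρ (i + 1), ⟨_, (h (i + 1)).1, _, hρ (i + 1)⟩, Or.inl (h (i + 1 + 1)).1⟩
        refine hD.2.1 ?_
        rw [hD.1.eq_mscc huD, heq, ← hC.eq_mscc (h (i + 1 + 1)).1]
  have key : ∀ u, A.dagReach w (A.dagIter w r) (ρ M, v.2 + M) u →
      (∃ i, M ≤ i ∧ u = (ρ i, v.2 + i)) ∨ A.IsEndangered w (A.dagIter w r) u := by
    intro u hu
    induction hu with
    | refl => exact Or.inl ⟨M, le_rfl, rfl⟩
    | tail _ he ih =>
      rcases ih with ⟨i, hi, rfl⟩ | ih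
      · rcases hsucc i hi _ he with h | h
        · exact Or.inl ⟨i + 1, by omega, h⟩
        · exact Or.inr h.1
      · exact Or.inr (ih.of_reach (Relation.ReflTransGen.single he))
  refine ((mem_dagIter_succ_of_odd hr).1 (dagIter_succ_subset _ (h M).2)).2 ⟨?_, ?_⟩
  · intro u hu hacc
    rcases key u hu with ⟨i, hi, rfl⟩ | h
    · exact hN i (by omega) (Or.inl hacc)
    · exact h.1 _ Relation.ReflTransGen.refl hacc
  · intro u x hu hux hacc
    rcases key u hu with ⟨i, hi, rfl⟩ | h'
    · rcases hsucc i hi x hux with rfl | ⟨-, D, hD, hxD⟩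
      · exact hN i (by omega) (Or.inr hacc)
      · exact not_mem_accTrans_of_child hA hC hD (h i).1 hxD hacc
    · exact h'.2 _ _ Relation.ReflTransGen.refl hux hacc

/-- Above the ranks of the children, every two steps of the ranking procedure remove from each
late level a vertex of `C` that is not accepting. -/
theorem rankLE_add_two_mul_ncard [Finite Q] [Finite Γ] (hw : w ∉ A.language) {C : Set Q}
    {m : ℕ} (hm : Even m) (hch : ∀ D, A.IsChild C D → A.RankLE w D m) :
    A.RankLE w C (m + 2 * (C \ A.acc).ncard) := by
  have hodd : ∀ i, Odd (m + 2 * i + 1) := fun i => (hm.add (even_two_mul i)).add_one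
  have hlevels : ∀ i, ∀ v : Q × ℕ, v.1 ∈ C → v ∈ A.dagIter w (m + 2 * i + 1) →
      ∃ K, ∀ k ≥ K, ∃ q ∈ C \ A.acc, (q, k) ∈ A.dagIter w (m + 2 * i + 1) ∧
        (q, k) ∉ A.dagIter w (m + 2 * i + 2) := by
    intro i v hvC hv
    obtain ⟨K, hK⟩ := exists_endangered_levels hw (hodd i) hv
    refine ⟨K, fun k hk => ?_⟩
    obtain ⟨q, hvq, hq, hq', hacc⟩ := hK k hk
    have key : ∀ u, A.dagReach w (A.dagIter w (m + 2 * i + 1)) v u → u.1 ∈ C := by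
      intro u hu
      induction hu with
      | refl => exact hvC
      | tail _ he ih =>
        refine (mem_or_mem_child ih he.2.2.2).resolve_right ?_
        rintro ⟨D, hD, hxD⟩
        exact (hch D hD).not_mem (by omega) hxD he.2.1
    exact ⟨q, ⟨key _ hvq, hacc⟩, hq, hq'⟩
  have hcount : ∀ i, ∀ v : Q × ℕ, v.1 ∈ C → v ∈ A.dagIter w (m + 2 * i + 1) →
      ∃ K, ∀ k ≥ K, i + {q ∈ C \ A.acc | (q, k) ∈ A.dagIter w (m + 2 * i + 1)}.ncard ≤
        (C \ A.acc).ncard := by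
    intro i
    induction i with
    | zero =>
      intro _ _ _
      refine ⟨0, fun k _ => ?_⟩
      rw [Nat.zero_add]
      exact Set.ncard_le_ncard (Set.sep_subset _ _)
    | succ i ih =>
      intro v hvC hv
      have hv' := dagIter_antitone (show m + 2 * i + 1 ≤ m + 2 * (i + 1) + 1 by omega) hv
      obtain ⟨K, hK⟩ := ih v hvC hv'
      obtain ⟨K', hK'⟩ := hlevels i v hvC hv'
      refine ⟨K + K', fun k hk => ?_⟩
      obtain ⟨q, hqC, hq, hq'⟩ := hK' k (by omega)
      have hlt : {q ∈ C \ A.acc | (q, k) ∈ A.dagIter w (m + 2 * (i + 1) + 1)}.ncard <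
          {q ∈ C \ A.acc | (q, k) ∈ A.dagIter w (m + 2 * i + 1)}.ncard := by
        refine Set.ncard_lt_ncard ⟨fun x hx => ⟨hx.1, dagIter_antitone (by omega) hx.2⟩,
          fun hsub => hq' ?_⟩
        exact dagIter_antitone (by omega) (hsub ⟨hqC, hq⟩).2
      have := hK k (by omega)
      omega
  intro v hvC hv
  obtain ⟨K, hK⟩ := hcount _ v hvC hv
  obtain ⟨K', hK'⟩ := hlevels _ v hvC hv
  obtain ⟨q, hqC, hq, -⟩ := hK' (K + K') (by omega)
  have hpos : 0 < {q ∈ C \ A.acc | (q, K + K') ∈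
      A.dagIter w (m + 2 * (C \ A.acc).ncard + 1)}.ncard :=
    (Set.ncard_pos).2 ⟨q, hqC, hq⟩
  have := hK (K + K') (by omega)
  omega

/-! ### Induction along the condensation -/

/-- The states reachable from `C`. -/
def reachSet (A : BuchiAutomaton Q Γ) (C : Set Q) : Set Q := {q | ∃ p ∈ C, A.Reach p q}

theorem ncard_reachSet_child_add_le [Finite Q] {C D : Set Q} (hC : A.IsMSCC C)
    (hD : A.IsChild C D) : (A.reachSet D).ncard + C.ncard ≤ (A.reachSet C).ncard := by
  obtain ⟨hDM, hne, p, hp, q, hq, a, ha⟩ := hD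
  have hpq : A.Reach p q := Relation.ReflTransGen.single ⟨a, ha⟩
  have hdisj : Disjoint (A.reachSet D) C := by
    refine Set.disjoint_left.2 ?_
    rintro x ⟨y, hy, hyx⟩ hx
    have hqC : q ∈ A.mscc p := ⟨hpq, ((hDM.1 q hq y hy).1.trans hyx).trans (hC.1 x hx p hp).1⟩
    rw [← hC.eq_mscc hp] at hqC
    exact hne ((hDM.eq_mscc hq).trans (hC.eq_mscc hqC).symm)
  rw [← Set.ncard_union_eq hdisj]
  refine Set.ncard_le_ncard (Set.union_subset ?_ fun x hx => ⟨x, hx, Relation.ReflTransGen.refl⟩)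
  rintro x ⟨y, hy, hyx⟩
  exact ⟨p, hp, (hpq.trans (hDM.1 q hq y hy).1).trans hyx⟩

theorem IsChild.ncard_pos [Finite Q] {C D : Set Q} (hD : A.IsChild C D) : 0 < C.ncard := by
  obtain ⟨p, hp, -⟩ := hD.2.2
  exact (Set.ncard_pos).2 ⟨p, hp⟩

theorem ncard_reachSet_child_lt [Finite Q] {C D : Set Q} (hC : A.IsMSCC C)
    (hD : A.IsChild C D) : (A.reachSet D).ncard < (A.reachSet C).ncard := by
  have := ncard_reachSet_child_add_le hC hD
  have := hD.ncard_pos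
  omega

theorem IsMSCC.induction [Finite Q] {P : Set Q → Prop}
    (h : ∀ C, A.IsMSCC C → (∀ D, A.IsChild C D → P D) → P C) (C : Set Q) (hC : A.IsMSCC C) :
    P C := by
  induction hn : (A.reachSet C).ncard using Nat.strong_induction_on generalizing C with
  | _ n ih =>
    exact h C hC fun D hD => ih _ (hn ▸ ncard_reachSet_child_lt hC hD) D hD.1 rfl

/-! ### Existence of labellings -/

section

variable [Finite Q] {L L' : CompLabelling Q} {C : Set Q}

/-- The labelling rules at the component `C`. -/
def LabelRule (A : BuchiAutomaton Q Γ) (L : CompLabelling Q) (C : Set Q) : Prop :=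
  (A.IsTerminal C → A.TerminalRule L C) ∧ (¬ A.IsTerminal C → A.InnerRule L C)

theorem childRank_congr (h : ∀ D, A.IsChild C D → L.typ D = L'.typ D ∧ L.rk D = L'.rk D) :
    A.childRank L C = A.childRank L' C := by
  funext t
  unfold childRank
  refine Finset.sup_congr ?_ fun D hD => ?_
  · ext D
    simp only [Set.Finite.mem_toFinset, Set.mem_ofPred_eq]
    exact and_congr_right fun hD => by rw [(h D hD).1]
  · simp only [Set.Finite.mem_toFinset, Set.mem_ofPred_eq] at hD
    rw [(h D hD.1).2]

theorem detIncr_congr (h : ∀ D, A.IsChild C D → L.typ D = L'.typ D ∧ L.rk D = L'.rk D) :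
    A.detIncr L C = A.detIncr L' C := by
  funext t
  have : (∀ D, A.IsChild C D → L.typ D = t →
        ((L.rk D : ℕ) : WithBot ℕ) = A.childRank L C t → A.IsDetBetween C D) ↔
      ∀ D, A.IsChild C D → L'.typ D = t →
        ((L'.rk D : ℕ) : WithBot ℕ) = A.childRank L' C t → A.IsDetBetween C D := by
    rw [childRank_congr h]
    refine forall_congr' fun D => forall_congr' fun hD => ?_
    rw [(h D hD).1, (h D hD).2]
  classical
  exact if_congr this rfl rfl

theorem labelRule_congr (hC : L.typ C = L'.typ C ∧ L.rk C = L'.rk C)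
    (h : ∀ D, A.IsChild C D → L.typ D = L'.typ D ∧ L.rk D = L'.rk D) :
    A.LabelRule L C ↔ A.LabelRule L' C := by
  simp only [LabelRule, TerminalRule, InnerRule, trivialRule, iwaRule, detRule, nonAccRule,
    generalRule, hC.1, hC.2, childRank_congr h, detIncr_congr h]

theorem le_childRank {D : Set Q} (hD : A.IsChild C D) :
    ((L.rk D : ℕ) : WithBot ℕ) ≤ A.childRank L C (L.typ D) :=
  Finset.le_sup (f := fun D => ((L.rk D : ℕ) : WithBot ℕ))
    (by simpa only [Set.Finite.mem_toFinset] using ⟨hD, rfl⟩)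

theorem exists_childRank_eq {t : CompType} {n : ℕ} (h : A.childRank L C t = (n : WithBot ℕ)) :
    ∃ D, A.IsChild C D ∧ L.typ D = t ∧ L.rk D = n := by
  have hne : (Set.toFinite {D : Set Q | A.IsChild C D ∧ L.typ D = t}).toFinset.Nonempty := by
    by_contra hne
    rw [Finset.not_nonempty_iff_eq_empty] at hne
    rw [childRank, hne, Finset.sup_empty] at h
    exact WithBot.bot_ne_coe h
  obtain ⟨D, hD, hDn⟩ := Finset.exists_mem_eq_sup _ hne
    fun D => ((L.rk D : ℕ) : WithBot ℕ)
  rw [Set.Finite.mem_toFinset] at hD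
  exact ⟨D, hD.1, hD.2, WithBot.coe_injective (hDn.symm.trans h)⟩

theorem childRank_le_trivialRule (t : CompType) : A.childRank L C t ≤ A.trivialRule L C := by
  cases t <;> simp [trivialRule]

theorem exists_childRank_eq_trivialRule (A : BuchiAutomaton Q Γ) (L : CompLabelling Q)
    (C : Set Q) : ∃ t, A.childRank L C t = A.trivialRule L C := by
  have h : ∀ x y : WithBot ℕ, (∃ t, A.childRank L C t = x) → (∃ t, A.childRank L C t = y) →
      ∃ t, A.childRank L C t = x ⊔ y := by
    intro x y hx hy
    rcases max_choice x y with h | h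
    · exact h.symm ▸ hx
    · exact h.symm ▸ hy
  exact h _ _ (h _ _ (h _ _ ⟨_, rfl⟩ ⟨_, rfl⟩) ⟨_, rfl⟩) ⟨_, rfl⟩

theorem exists_coe_eq_of_le {x y : WithBot ℕ} (hx : ∃ n : ℕ, (n : WithBot ℕ) ≤ x) (h : x ≤ y) :
    ∃ n : ℕ, (n : WithBot ℕ) = y := by
  obtain ⟨n, hn⟩ := hx
  exact WithBot.ne_bot_iff_exists.1 fun hy => WithBot.coe_ne_bot (le_bot_iff.1 (hy ▸ hn.trans h))

/-- Once the children of `C` are labelled, the rules can be satisfied at `C`. -/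
theorem exists_label (A : BuchiAutomaton Q Γ) (L : CompLabelling Q) (C : Set Q) :
    ∃ L' : CompLabelling Q, (∀ D, D ≠ C → L.typ D = L'.typ D ∧ L.rk D = L'.rk D) ∧
      A.LabelRule L' C := by
  classical
  suffices h : ∃ (t : CompType) (n : ℕ), ∀ L' : CompLabelling Q, L'.typ C = t → L'.rk C = n →
      (∀ D, A.IsChild C D → L'.typ D = L.typ D ∧ L'.rk D = L.rk D) → A.LabelRule L' C by
    obtain ⟨t, n, h⟩ := h
    refine ⟨⟨Function.update L.typ C t, Function.update L.rk C n⟩,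
      fun D hD => by simp [Function.update_of_ne hD], h _ (by simp) (by simp) fun D hD => ?_⟩
    simp [Function.update_of_ne hD.2.1]
  by_cases hT : A.IsTerminal C
  · by_cases h1 : A.IsIWA C
    · exact ⟨.IWA, 0, fun L' h h' _ => ⟨fun _ => by simp [TerminalRule, h1, h, h'],
        fun hn => absurd hT hn⟩⟩
    by_cases h2 : A.IsDet C ∧ ¬ A.IsNonAcc C
    · exact ⟨.D, 2, fun L' h h' _ => ⟨fun _ => by simp [TerminalRule, h1, h2, h, h'],
        fun hn => absurd hT hn⟩⟩
    · exact ⟨.G, 2 * (C \ A.acc).ncard, fun L' h h' _ =>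
        ⟨fun _ => by rw [TerminalRule, if_neg h1, if_neg h2]; exact ⟨h, h'⟩,
          fun hn => absurd hT hn⟩⟩
  have hbase : ∃ n : ℕ, (n : WithBot ℕ) ≤ A.trivialRule L C := by
    obtain ⟨D, hD⟩ := not_forall_not.1 hT
    exact ⟨L.rk D, (le_childRank hD).trans (childRank_le_trivialRule _)⟩
  have hself : ∀ x : WithBot ℕ, x ≤ x + 1 := fun x => le_add_of_nonneg_right zero_le_one
  have hself2 : ∀ (x : WithBot ℕ) (k : ℕ), x ≤ x + (k : WithBot ℕ) := fun x k =>
    le_add_of_nonneg_right (by exact_mod_cast Nat.zero_le k)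
  have hiwa : A.trivialRule L C ≤ A.iwaRule L C :=
    sup_le_sup (sup_le_sup (sup_le_sup le_rfl (hself _)) le_rfl) le_rfl
  have hdet : ∃ n : ℕ, (n : WithBot ℕ) = A.detRule L C :=
    exists_coe_eq_of_le ⟨2, le_rfl⟩ le_sup_right
  have hnon : A.trivialRule L C ≤ A.nonAccRule L C :=
    sup_le_sup (sup_le_sup (sup_le_sup (hself _) le_rfl) (hself _)) (hself _)
  have hgen : A.trivialRule L C ≤ A.generalRule L C := hiwa.trans (hself2 _ _)
  -- It remains to find a label for which the rule holds with the child ranks computed from `L`.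
  suffices h : ∃ (t : CompType) (n : ℕ), ∀ L' : CompLabelling Q, L'.typ C = t → L'.rk C = n →
      A.childRank L' C = A.childRank L C → A.detIncr L' C = A.detIncr L C → A.InnerRule L' C by
    obtain ⟨t, n, h⟩ := h
    exact ⟨t, n, fun L' ht hn hL => ⟨fun h => absurd h hT,
      fun _ => h L' ht hn (childRank_congr hL) (detIncr_congr hL)⟩⟩
  by_cases h0 : A.IsTrivialComp C
  · obtain ⟨t, ht⟩ := exists_childRank_eq_trivialRule A L C
    obtain ⟨n, hn⟩ := exists_coe_eq_of_le hbase le_rfl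
    refine ⟨t, n, fun L' h h' hc _ => ?_⟩
    rw [InnerRule, if_pos h0, trivialRule, hc, h, h']
    exact ⟨hn, ht⟩
  by_cases h1 : A.IsIWA C
  · obtain ⟨n, hn⟩ := exists_coe_eq_of_le hbase hiwa
    refine ⟨.IWA, n, fun L' h h' hc _ => ?_⟩
    rw [InnerRule, if_neg h0, if_pos h1, iwaRule, hc, h, h']
    exact ⟨rfl, hn⟩
  by_cases h2 : A.IsDet C ∧ ¬ A.IsNonAcc C
  · obtain ⟨n, hn⟩ := hdet
    refine ⟨.D, n, fun L' h h' hc hd => ?_⟩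
    rw [InnerRule, if_neg h0, if_neg h1, if_pos h2, detRule, hc, hd, h, h']
    exact ⟨rfl, hn⟩
  by_cases h3 : A.IsDet C ∧ A.IsNonAcc C
  · rcases le_total (A.detRule L C) (A.nonAccRule L C) with hle | hle
    · obtain ⟨n, hn⟩ := hdet
      refine ⟨.D, n, fun L' h h' hc hd => ?_⟩
      rw [InnerRule, if_neg h0, if_neg h1, if_neg h2, if_pos h3, detRule, nonAccRule, hc, hd, h, h']
      exact Or.inl ⟨rfl, hn, hle⟩
    · obtain ⟨n, hn⟩ := exists_coe_eq_of_le hbase hnon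
      refine ⟨.N, n, fun L' h h' hc hd => ?_⟩
      rw [InnerRule, if_neg h0, if_neg h1, if_neg h2, if_pos h3, detRule, nonAccRule, hc, hd, h, h']
      exact Or.inr ⟨rfl, hn, hle⟩
  by_cases h4 : A.IsNonAcc C
  · obtain ⟨n, hn⟩ := exists_coe_eq_of_le hbase hnon
    refine ⟨.N, n, fun L' h h' hc _ => ?_⟩
    rw [InnerRule, if_neg h0, if_neg h1, if_neg h2, if_neg h3, if_pos h4, nonAccRule, hc, h, h']
    exact ⟨rfl, hn⟩
  · obtain ⟨n, hn⟩ := exists_coe_eq_of_le hbase hgen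
    refine ⟨.G, n, fun L' h h' hc _ => ?_⟩
    rw [InnerRule, if_neg h0, if_neg h1, if_neg h2, if_neg h3, if_neg h4, generalRule, hc, h, h']
    exact ⟨rfl, hn⟩

/-- Labels are assigned to the components in order of the number of states they reach. -/
theorem exists_isLabelling (A : BuchiAutomaton Q Γ) : ∃ L : CompLabelling Q, A.IsLabelling L := by
  classical
  suffices h : ∀ n, ∃ L : CompLabelling Q, ∀ C, A.IsMSCC C → (A.reachSet C).ncard < n →
      A.LabelRule L C by
    obtain ⟨L, hL⟩ := h (Nat.card Q + 1)
    exact ⟨L, fun C hC => hL C hC (Nat.lt_succ_of_le (Set.ncard_le_card _))⟩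
  intro n
  induction n with
  | zero => exact ⟨⟨fun _ => .G, fun _ => 0⟩, fun _ _ h => absurd h (Nat.not_lt_zero _)⟩
  | succ n ih =>
    obtain ⟨L, hL⟩ := ih
    choose M hM hMC using exists_label A L
    let L' : CompLabelling Q :=
      ⟨fun C => if (A.reachSet C).ncard < n then L.typ C else (M C).typ C,
        fun C => if (A.reachSet C).ncard < n then L.rk C else (M C).rk C⟩
    have hlt : ∀ C, (A.reachSet C).ncard < n → L'.typ C = L.typ C ∧ L'.rk C = L.rk C :=
      fun C h => by simp [L', h]
    have hge : ∀ C, ¬ (A.reachSet C).ncard < n →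
        L'.typ C = (M C).typ C ∧ L'.rk C = (M C).rk C := fun C h => by simp [L', h]
    refine ⟨L', fun C hC hCn => ?_⟩
    have hchild : ∀ D, A.IsChild C D → L'.typ D = L.typ D ∧ L'.rk D = L.rk D := fun D hD =>
      hlt D (by have := ncard_reachSet_child_lt hC hD; omega)
    by_cases h : (A.reachSet C).ncard < n
    · exact (labelRule_congr (hlt C h) hchild).2 (hL C hC h)
    · refine (labelRule_congr (hge C h) fun D hD => ?_).2 (hMC C)
      obtain ⟨h1, h2⟩ := hM C D hD.2.1
      exact ⟨(hchild D hD).1.trans h1, (hchild D hD).2.trans h2⟩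

end

/-! ### Parity and size of the ranks of a labelling -/

section

variable [Finite Q] {L : CompLabelling Q} {C : Set Q}

/-- The parity of the ranks of components of type `t`: odd for `N`, even otherwise. -/
def typeParity : CompType → ℕ
  | .N => 1
  | _ => 0

/-- `x` is `⊥` or has parity `b`. -/
def HasParity (x : WithBot ℕ) (b : ℕ) : Prop := ∀ n : ℕ, x = (n : WithBot ℕ) → n % 2 = b

theorem HasParity.sup {x y : WithBot ℕ} {b : ℕ} (hx : HasParity x b) (hy : HasParity y b) :
    HasParity (x ⊔ y) b := by
  rcases max_choice x y with h | h
  · exact h.symm ▸ hx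
  · exact h.symm ▸ hy

theorem exists_add_eq_of_eq_natCast {x y : WithBot ℕ} {n : ℕ} (h : x + y = (n : WithBot ℕ)) :
    ∃ k l : ℕ, x = (k : WithBot ℕ) ∧ y = (l : WithBot ℕ) ∧ k + l = n := by
  obtain ⟨k, l, hk, hl, hkl⟩ := WithBot.add_eq_coe.1 h
  exact ⟨k, l, hk.symm, hl.symm, hkl⟩

theorem HasParity.add {x y : WithBot ℕ} {b c d : ℕ} (hx : HasParity x b) (hy : HasParity y c)
    (h : (b + c) % 2 = d) : HasParity (x + y) d := by
  intro n hn
  obtain ⟨k, l, hk, hl, hkl⟩ := exists_add_eq_of_eq_natCast hn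
  have := hx k hk
  have := hy l hl
  omega

theorem hasParity_coe {n b : ℕ} (h : n % 2 = b) : HasParity (n : WithBot ℕ) b :=
  fun m hm => by rwa [← Nat.cast_injective (R := WithBot ℕ) hm]

theorem detIncr_eq (A : BuchiAutomaton Q Γ) (L : CompLabelling Q) (C : Set Q) (t : CompType) :
    A.detIncr L C t = ((0 : ℕ) : WithBot ℕ) ∨ A.detIncr L C t = ((2 : ℕ) : WithBot ℕ) := by
  unfold detIncr
  split_ifs
  · exact Or.inl rfl
  · exact Or.inr rfl

theorem hasParity_detIncr (t : CompType) : HasParity (A.detIncr L C t) 0 := by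
  rcases detIncr_eq A L C t with h | h <;> exact h ▸ hasParity_coe rfl

/-- In a labelling, ranks have the parity prescribed by the type. -/
theorem IsLabelling.rk_mod_two (hL : A.IsLabelling L) :
    ∀ C, A.IsMSCC C → L.rk C % 2 = typeParity (L.typ C) := by
  refine IsMSCC.induction fun C hC ih => ?_
  by_cases hT : A.IsTerminal C
  · have h := (hL C hC).1 hT
    unfold TerminalRule at h
    split_ifs at h <;> simp [h, typeParity]
  have hch : ∀ t, HasParity (A.childRank L C t) (typeParity t) := by
    intro t n hn
    obtain ⟨D, hD, rfl, rfl⟩ := exists_childRank_eq hn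
    exact ih D hD
  have h1 : HasParity 1 1 := hasParity_coe rfl
  have h2 : HasParity 2 0 := hasParity_coe rfl
  have hI : HasParity (A.childRank L C .D ⊔ (A.childRank L C .N + 1) ⊔
      A.childRank L C .IWA ⊔ A.childRank L C .G) 0 :=
    (((hch .D).sup ((hch .N).add h1 rfl)).sup (hch .IWA)).sup (hch .G)
  have hD : HasParity (A.detRule L C) 0 :=
    (((((hch .D).add (hasParity_detIncr _) rfl).sup ((hch .N).add h1 rfl)).sup
      ((hch .IWA).add (hasParity_detIncr _) rfl)).sup ((hch .G).add h2 rfl)).sup h2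
  have hN : HasParity (A.nonAccRule L C) 1 :=
    ((((hch .D).add h1 rfl).sup (hch .N)).sup ((hch .IWA).add h1 rfl)).sup ((hch .G).add h1 rfl)
  have h := (hL C hC).2 hT
  unfold InnerRule at h
  split_ifs at h
  · exact hch _ _ (h.2.trans h.1.symm)
  · rw [h.1]; exact hI _ h.2.symm
  · rw [h.1]; exact hD _ h.2.symm
  · rcases h with h | h
    · rw [h.1]; exact hD _ h.2.1.symm
    · rw [h.1]; exact hN _ h.2.1.symm
  · rw [h.1]; exact hN _ h.2.symm
  · rw [h.1]; exact hI.add (hasParity_coe (b := 0) (by simp)) rfl _ h.2.symm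

theorem childRank_le {B : ℕ} (h : ∀ D, A.IsChild C D → L.rk D ≤ B) (t : CompType) :
    A.childRank L C t ≤ (B : WithBot ℕ) :=
  Finset.sup_le fun D hD => by
    rw [Set.Finite.mem_toFinset] at hD
    exact (Nat.cast_le (α := WithBot ℕ)).2 (h D hD.1)

/-- The rank of a component is at most twice the number of states that it reaches. For a child of
type `N` the bound is not attained by parity, which leaves room for the increments by one. -/
theorem IsLabelling.rk_le (hL : A.IsLabelling L) :
    ∀ C, A.IsMSCC C → L.rk C ≤ 2 * (A.reachSet C).ncard := by
  refine IsMSCC.induction fun C hC ih => ?_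
  have hCR : C.ncard ≤ (A.reachSet C).ncard :=
    Set.ncard_le_ncard fun x hx => ⟨x, hx, Relation.ReflTransGen.refl⟩
  have hdiff : (C \ A.acc).ncard ≤ C.ncard := Set.ncard_le_ncard Set.sdiff_subset
  by_cases hT : A.IsTerminal C
  · have h := (hL C hC).1 hT
    unfold TerminalRule at h
    split_ifs at h with h1 h2
    · omega
    · have hpos : 0 < C.ncard := by
        refine (Set.ncard_pos).2 (Set.nonempty_iff_ne_empty.2 fun h0 => h2.2 ?_)
        subst h0
        exact ⟨fun _ h => h.elim, fun _ h => h.elim⟩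
      omega
    · omega
  obtain ⟨M, hM⟩ : ∃ M, M + C.ncard = (A.reachSet C).ncard := ⟨_, Nat.sub_add_cancel hCR⟩
  obtain ⟨D₀, hD₀⟩ := not_forall_not.1 hT
  have hpos := hD₀.ncard_pos
  have hch : ∀ t, A.childRank L C t ≤ ((2 * M : ℕ) : WithBot ℕ) := childRank_le fun D hD => by
    have := ih D hD
    have := ncard_reachSet_child_add_le hC hD
    omega
  have hchN : A.childRank L C .N + 1 ≤ ((2 * M : ℕ) : WithBot ℕ) := by
    cases hx : A.childRank L C .N with
    | bot => simp
    | coe n =>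
      obtain ⟨D, hD, hDN, rfl⟩ := exists_childRank_eq hx
      have h1 := hL.rk_mod_two D hD.1
      rw [hDN] at h1
      have h2 : L.rk D ≤ 2 * M := (Nat.cast_le (α := WithBot ℕ)).1 (hx.ge.trans (hch .N))
      simp only [typeParity] at h1
      have h3 : L.rk D + 1 ≤ 2 * M := by omega
      exact (Nat.cast_le (α := WithBot ℕ)).2 h3
  have hup : ∀ {x : WithBot ℕ} {B B' : ℕ}, x ≤ (B : WithBot ℕ) → B ≤ B' →
      x ≤ (B' : WithBot ℕ) := fun hx hB => hx.trans ((Nat.cast_le (α := WithBot ℕ)).2 hB)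
  have hadd : ∀ {x y : WithBot ℕ} {B B' : ℕ}, x ≤ (B : WithBot ℕ) → y ≤ (B' : WithBot ℕ) →
      x + y ≤ ((B + B' : ℕ) : WithBot ℕ) := fun hx hy => by
    rw [Nat.cast_add]
    exact add_le_add hx hy
  have hinc : ∀ t, A.detIncr L C t ≤ ((2 : ℕ) : WithBot ℕ) := fun t => by
    rcases detIncr_eq A L C t with h | h
    · rw [h]; exact (Nat.cast_le (α := WithBot ℕ)).2 (by norm_num)
    · rw [h]
  have hI : A.childRank L C .D ⊔ (A.childRank L C .N + 1) ⊔
      A.childRank L C .IWA ⊔ A.childRank L C .G ≤ ((2 * M : ℕ) : WithBot ℕ) :=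
    sup_le (sup_le (sup_le (hch _) hchN) (hch _)) (hch _)
  have hD : A.detRule L C ≤ ((2 * M + 2 : ℕ) : WithBot ℕ) :=
    sup_le (sup_le (sup_le (sup_le (hadd (hch _) (hinc _)) (hup hchN (by omega)))
      (hadd (hch _) (hinc _))) (hadd (hch _) le_rfl)) (hup (B := 2) le_rfl (by omega))
  have hN : A.nonAccRule L C ≤ ((2 * M + 1 : ℕ) : WithBot ℕ) :=
    sup_le (sup_le (sup_le (hadd (hch _) le_rfl) (hup (hch _) (by omega)))
      (hadd (hch _) le_rfl)) (hadd (hch _) le_rfl)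
  suffices hrk : ((L.rk C : ℕ) : WithBot ℕ) ≤ ((2 * M + 2 * C.ncard : ℕ) : WithBot ℕ) by
    have := (Nat.cast_le (α := WithBot ℕ)).1 hrk
    omega
  have h := (hL C hC).2 hT
  unfold InnerRule at h
  split_ifs at h
  · rw [← h.1] at h
    exact h.2 ▸ hup (hch _) (by omega)
  · exact h.2 ▸ hup hI (by omega)
  · exact h.2 ▸ hup hD (by omega)
  · rcases h with h | h
    · exact h.2.1 ▸ hup hD (by omega)
    · exact h.2.1 ▸ hup hN (by omega)
  · exact h.2 ▸ hup hN (by omega)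
  · exact h.2 ▸ hup (hadd hI le_rfl) (by omega)

theorem IsLabelling.even_chi (hA : A.AccInsideNontrivial) (hL : A.IsLabelling L) {q : Q}
    (hq : q ∈ A.acc) : Even (A.chi L q) := by
  have hC := A.isMSCC_mscc q
  have hmem := A.mem_mscc q
  have hNT : ¬ A.IsTrivialComp (A.mscc q) := by
    obtain ⟨C, hCM, hCT, hqC⟩ := hA.1 q hq
    rwa [hCM.eq_mscc hqC] at hCT
  have hNA : ¬ A.IsNonAcc (A.mscc q) := fun h => h.1 q hmem hq
  have hN : L.typ (A.mscc q) ≠ .N := by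
    intro ht
    by_cases hT : A.IsTerminal (A.mscc q)
    · have h := (hL _ hC).1 hT
      unfold TerminalRule at h
      split_ifs at h <;> simp [ht] at h
    · have h := (hL _ hC).2 hT
      unfold InnerRule at h
      simp only [if_neg hNT, hNA, and_false, if_false, ht] at h
      split_ifs at h <;> simp at h
  have hpar := hL.rk_mod_two _ hC
  rw [Nat.even_iff, chi, hpar]
  cases ht : L.typ (A.mscc q) <;> first | rfl | exact absurd ht hN

/-! ### The ranks of a labelling bound the ranks of vertices -/

theorem rk_le_iwaRule {D : Set Q} (hD : A.IsChild C D) :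
    ((L.rk D : ℕ) : WithBot ℕ) ≤ A.iwaRule L C := by
  refine (le_childRank hD).trans ?_
  have hself : A.childRank L C .N ≤ A.childRank L C .N + 1 := le_add_of_nonneg_right zero_le_one
  unfold iwaRule
  cases L.typ D
  · exact le_sup_right.trans le_sup_left
  · exact (le_sup_left.trans le_sup_left).trans le_sup_left
  · exact hself.trans ((le_sup_right.trans le_sup_left).trans le_sup_left)
  · exact le_sup_right

theorem rk_le_nonAccRule {D : Set Q} (hD : A.IsChild C D) :
    ((L.rk D : ℕ) : WithBot ℕ) ≤ A.nonAccRule L C := by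
  refine (le_childRank hD).trans ?_
  have hself : ∀ x : WithBot ℕ, x ≤ x + 1 := fun x => le_add_of_nonneg_right zero_le_one
  unfold nonAccRule
  cases L.typ D
  · exact (hself _).trans (le_sup_right.trans le_sup_left)
  · exact (hself _).trans ((le_sup_left.trans le_sup_left).trans le_sup_left)
  · exact (le_sup_right.trans le_sup_left).trans le_sup_left
  · exact (hself _).trans le_sup_right

/-- A child with maximal rank among those of its type is entered deterministically or pays the
increment; any other child has smaller rank. -/
theorem lt_or_isDetBetween_of_add_detIncr_le {D : Set Q} (hD : A.IsChild C D) {r : ℕ}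
    (h : A.childRank L C (L.typ D) + A.detIncr L C (L.typ D) ≤ (r : WithBot ℕ)) :
    L.rk D < r ∨ (A.IsDetBetween C D ∧ L.rk D ≤ r) := by
  have hle := le_childRank (L := L) hD
  have h0 : ((L.rk D : ℕ) : WithBot ℕ) + A.detIncr L C (L.typ D) ≤ (r : WithBot ℕ) :=
    (add_le_add hle le_rfl).trans h
  by_cases hmax : ((L.rk D : ℕ) : WithBot ℕ) = A.childRank L C (L.typ D)
  · by_cases hdb : A.IsDetBetween C D
    · right
      rcases detIncr_eq A L C (L.typ D) with h' | h' <;>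
        rw [h', ← Nat.cast_add, Nat.cast_le (α := WithBot ℕ)] at h0 <;> exact ⟨hdb, by omega⟩
    · left
      have hi : A.detIncr L C (L.typ D) = ((2 : ℕ) : WithBot ℕ) :=
        if_neg fun hall => hdb (hall D hD rfl hmax)
      rw [hi, ← Nat.cast_add, Nat.cast_le (α := WithBot ℕ)] at h0
      omega
  · left
    have hlt : ((L.rk D : ℕ) : WithBot ℕ) < A.childRank L C (L.typ D) := lt_of_le_of_ne hle hmax
    refine (Nat.cast_lt (α := WithBot ℕ)).1 (hlt.trans_le (le_trans (le_add_of_nonneg_right ?_) h))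
    rcases detIncr_eq A L C (L.typ D) with h' | h' <;> rw [h'] <;>
      exact (Nat.cast_le (α := WithBot ℕ)).2 (Nat.zero_le _)

theorem lt_or_isDetBetween_of_detRule {D : Set Q} (hD : A.IsChild C D) {r : ℕ}
    (h : A.detRule L C ≤ (r : WithBot ℕ)) :
    L.rk D < r ∨ (A.IsDetBetween C D ∧ L.rk D ≤ r) := by
  simp only [detRule, sup_le_iff] at h
  obtain ⟨⟨⟨⟨hDD, hN⟩, hW⟩, hG⟩, -⟩ := h
  have hle := le_childRank (L := L) hD
  cases ht : L.typ D
  · exact lt_or_isDetBetween_of_add_detIncr_le hD (by rwa [ht])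
  · exact lt_or_isDetBetween_of_add_detIncr_le hD (by rwa [ht])
  · rw [ht] at hle
    have h1 : ((L.rk D + 1 : ℕ) : WithBot ℕ) ≤ (r : WithBot ℕ) :=
      (add_le_add hle le_rfl).trans hN
    exact Or.inl ((Nat.cast_le (α := WithBot ℕ)).1 h1)
  · rw [ht] at hle
    have h1 : ((L.rk D + 2 : ℕ) : WithBot ℕ) ≤ (r : WithBot ℕ) :=
      (add_le_add hle le_rfl).trans hG
    have := (Nat.cast_le (α := WithBot ℕ)).1 h1
    exact Or.inl (by omega)

/-- On a rejected word every vertex has at most the rank of its component. -/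
theorem IsLabelling.rankLE [Finite Γ] (hA : A.AccInsideNontrivial) (hw : w ∉ A.language)
    (hL : A.IsLabelling L) : ∀ C, A.IsMSCC C → A.RankLE w C (L.rk C) := by
  refine IsMSCC.induction fun C hC ih => ?_
  have hpar := hL.rk_mod_two C hC
  by_cases hT : A.IsTerminal C
  · have hno : ∀ {P : Set Q → Prop}, ∀ D, A.IsChild C D → P D := fun D hD => absurd hD (hT D)
    have h := (hL C hC).1 hT
    unfold TerminalRule at h
    split_ifs at h with h1 h2
    · rw [h.2]
      exact rankLE_of_isIWA hw h1 Even.zero hno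
    · rw [h.2]
      exact rankLE_of_isDet hA hw hC h2.1 odd_one hno
    · rw [h.2, ← Nat.zero_add (2 * _)]
      exact rankLE_add_two_mul_ncard hw Even.zero hno
  have hdet : A.IsDet C → L.typ C = .D → ((L.rk C : ℕ) : WithBot ℕ) = A.detRule L C →
      A.RankLE w C (L.rk C) := by
    intro hd ht hrk
    rw [ht] at hpar
    have h2 : ((2 : ℕ) : WithBot ℕ) ≤ ((L.rk C : ℕ) : WithBot ℕ) := by
      rw [hrk]
      exact le_sup_right
    have h2 := (Nat.cast_le (α := WithBot ℕ)).1 h2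
    obtain ⟨r, hr⟩ : ∃ r, L.rk C = r + 1 := Nat.exists_eq_succ_of_ne_zero (by omega)
    have hodd : Odd r := Nat.odd_iff.2 (by simp only [typeParity] at hpar; omega)
    rw [hr]
    refine rankLE_of_isDet hA hw hC hd hodd fun D hD => ?_
    rcases lt_or_isDetBetween_of_detRule hD hrk.ge with h | h
    · exact Or.inl ((ih D hD).mono (by omega))
    · exact Or.inr ⟨h.1, (ih D hD).mono (by omega)⟩
  have hnon : A.IsNonAcc C → L.typ C = .N → ((L.rk C : ℕ) : WithBot ℕ) = A.nonAccRule L C →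
      A.RankLE w C (L.rk C) := by
    intro hn ht hrk
    rw [ht] at hpar
    refine rankLE_of_isNonAcc hA hC hn (Nat.odd_iff.2 hpar) fun D hD => (ih D hD).mono ?_
    exact (Nat.cast_le (α := WithBot ℕ)).1 ((rk_le_nonAccRule hD).trans hrk.ge)
  have h := (hL C hC).2 hT
  unfold InnerRule at h
  split_ifs at h with h0 h1 h2 h3 h4
  · refine rankLE_of_isTrivialComp hA hC h0 fun D hD => (ih D hD).mono ?_
    exact (Nat.cast_le (α := WithBot ℕ)).1 
      (((le_childRank hD).trans (childRank_le_trivialRule _)).trans h.1.ge)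
  · rw [h.1] at hpar
    refine rankLE_of_isIWA hw h1 (Nat.even_iff.2 hpar) fun D hD => (ih D hD).mono ?_
    exact (Nat.cast_le (α := WithBot ℕ)).1 ((rk_le_iwaRule hD).trans h.2.ge)
  · exact hdet h2.1 h.1 h.2
  · rcases h with h | h
    · exact hdet h3.1 h.1 h.2.1
    · exact hnon h3.2 h.1 h.2.1
  · exact hnon h4 h.1 h.2
  · rw [h.1] at hpar
    obtain ⟨m, c, hm, hc, hmc⟩ := exists_add_eq_of_eq_natCast h.2.symm
    have hc := Nat.cast_injective (R := WithBot ℕ) hc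
    simp only [typeParity] at hpar
    rw [← hmc, ← hc]
    refine rankLE_add_two_mul_ncard hw (Nat.even_iff.2 (by omega)) fun D hD => (ih D hD).mono ?_
    exact (Nat.cast_le (α := WithBot ℕ)).1 ((rk_le_iwaRule hD).trans hm.le)

end

end BuchiAutomaton

theorem mainTheorem2 {Q Γ : Type*} [Finite Q] [Finite Γ] [Nonempty Γ]
    (A : BuchiAutomaton Q Γ) (hA : A.AccInsideNontrivial) :
    (∃ L : CompLabelling Q, A.IsLabelling L) ∧
      ∀ L : CompLabelling Q, A.IsLabelling L →
        A.IsTrub (fun _ q => ((A.chi L q : ℕ) : ℕ∞)) := by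
  refine ⟨BuchiAutomaton.exists_isLabelling A, fun L hL => ?_⟩
  have hchi : ∀ q, A.chi L q ≤ 2 * Nat.card Q := fun q =>
    (hL.rk_le _ (A.isMSCC_mscc q)).trans (Nat.mul_le_mul_left 2 (Set.ncard_le_card _))
  refine ⟨fun _ => ⟨fun q => Nat.cast_le.2 (hchi q), fun q hq => ⟨_, hL.even_chi hA hq, rfl⟩⟩,
    fun w hw hrun => ?_⟩
  have hrank : ∀ v : Q × ℕ, v ∉ A.dagIter w (A.chi L v.1 + 1) := fun v =>
    hL.rankLE hA hw _ (A.isMSCC_mscc v.1) v (A.mem_mscc v.1)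
  obtain ⟨l, hl⟩ := BuchiAutomaton.exists_isTightLevel hw hrun fun v hv =>
    hrank v (BuchiAutomaton.dagIter_antitone (Nat.succ_le_succ (hchi v.1)) hv)
  refine ⟨l, hl, fun k _ q => ?_⟩
  by_cases hq : q ∈ A.level w k
  · obtain ⟨j, hj, hj1, hj2⟩ := BuchiAutomaton.exists_removal hq (hrank (q, k))
    rw [BuchiAutomaton.levelRanking, if_pos hq,
      BuchiAutomaton.vertexRank_eq (hj.trans (hchi q)) hj1 hj2]
    exact Nat.cast_le.2 hj
  · rw [BuchiAutomaton.levelRanking, if_neg hq]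
    exact bot_le
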